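/- Let $M$ be a smooth (Hausdorff, second countable) manifold of dimension $4n+3$, $n\ge 0$, with an almost $3$-contact metric structure $(\varphi_i,\xi_i,\eta_i,g)_{i=1,2,3}$: $g$ is a Riemannian metric, $\varphi_i$ are $(1,1)$-tensor fields, $\xi_i$ vector fields, $\eta_i$ $1$-forms, all smooth, with $\varphi_i^2=-I+\eta_i\otimes\xi_i$, $\eta_i(\xi_i)=1$, $g(\varphi_iX,\varphi_iY)=g(X,Y)-\eta_i(X)\eta_i(Y)$, and, for every even permutation $(i,j,k)$ of $(1,2,3)$, $$\varphi_k=\varphi_i\varphi_j-\eta_j\otimes\xi_i=-\varphi_j\varphi_i+\eta_i\otimes\xi_j,\quad \xi_k=\varphi_i\xi_j=-\varphi_j\xi_i,\quad \eta_k=\eta_i\circ\varphi_j=-\eta_j\circ\varphi_i .$$ Notation. $\mathcal H=\bigcap_i\ker\eta_i$ and $\mathcal V=\langle\xi_1,\xi_2,\xi_3\rangle$. For $a\in\mathbb R^3$ with $|a|=1$ put $\varphi_a=\sum_i a_i\varphi_i$, $\xi_a=\sum_i a_i\xi_i$, $\eta_a=\sum_i a_i\eta_i$; the structures $(\varphi_a,\xi_a,\eta_a)$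 form the associated sphere $\Sigma_M$. For such a structure $(\varphi,\xi,\eta)$ let $\Phi(X,Y)=g(X,\varphi Y)$ and $N_\varphi(X,Y)=[\varphi X,\varphi Y]+\varphi^2[X,Y]-\varphi[\varphi X,Y]-\varphi[X,\varphi Y]+d\eta(X,Y)\xi$, $N_\varphi(X,Y,Z)=g(N_\varphi(X,Y),Z)$. Exterior derivatives are taken without numerical factors: $d\eta(X,Y)=X\eta(Y)-Y\eta(X)-\eta([X,Y])$, and likewise $d\Phi$. For $X,Y\in\Gamma(\mathcal H)$ let $$A_{ij}(X,Y)=g((\mathcal L_{\xi_j}\varphi_i)X,Y)+d\eta_j(X,\varphi_iY)+d\eta_j(\varphi_iX,Y).$$ A function $\beta\in C^\infty(M)$ is a *Reeb Killing function* if $A_{ii}=0$ and $A_{ij}=-A_{ji}=\beta\Phi_k$ on $\mathcal H$ for every even permutation $(i,j,k)$. A function $\delta\in C^\infty(M)$ is a *Reeb commutator function* if $\eta_k([\xi_i,\xi_j])=2\delta\epsilon_{ijk}$ for all $i,j,k$. The manifold is *canonical* if (1) each $N_{\varphi_i}$ is a $3$-form on $\mathcal H$; (2) each $\xi_i$ is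 Killing; (3) $N_{\varphi_i}(X,Y,Z)-d\Phi_i(\varphi_iX,\varphi_iY,\varphi_iZ)=N_{\varphi_j}(X,Y,Z)-d\Phi_j(\varphi_jX,\varphi_jY,\varphi_jZ)$ for all $X,Y,Z\in\Gamma(\mathcal H)$ and all $i,j$; (4) it admits a Reeb Killing function. A smooth metric connection $\nabla$ with torsion $T$ has *skew torsion* if $T(X,Y,Z)=g(T(X,Y),Z)$ is a $3$-form; it is *$\varphi$-compatible* if it is metric with skew torsion, preserves $TM=\mathcal H\oplus\mathcal V$, and $(\nabla_X\varphi)Y=0$ for all $X,Y\in\Gamma(\mathcal H)$. **Theorem (Existence of the canonical connection).** $M$ admits a metric connection $\nabla$ with skew torsion such that for some smooth function $\tilde\beta$ $$\nabla_X\varphi_i=\tilde\beta\,(\eta_k(X)\varphi_j-\eta_j(X)\varphi_k)\qquad (*)$$ for every vector field $X$ and every even permutation $(i,j,k)$ of $(1,2,3)$, if and only if $M$ is canonical. If $n\ge1$, the pair $(\nabla,\tilde\beta)$ is then unique. For every such pair: - $\nabla$ is $\varphi$-compatible for every $\varphi\in\Sigma_M$; - $\tilde\beta$ is a Reeb Killing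 function, and for $n\ge1$ it is the only one; - for every $\varphi\in\Sigma_M$, all $X,Y,Z\in\Gamma(\mathcal H)$ and all $i,j$, $$T(X,Y,Z)=N_\varphi(X,Y,Z)-d\Phi(\varphi X,\varphi Y,\varphi Z),\quad T(X,Y,\xi_i)=d\eta_i(X,Y),\quad T(X,\xi_i,\xi_j)=-g([\xi_i,\xi_j],X);$$ - $M$ admits a Reeb commutator function $\delta$, and $T(\xi_1,\xi_2,\xi_3)=2(\tilde\beta-\delta)$. -/

import Mathlib

open Bundle
open scoped Manifold ContDiff

noncomputable section

namespace ThreeContact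

/-! ### Tensor calculus on a smooth manifold

Vector fields are sections `X : Π x : M, TangentSpace I x`. All conventions for exterior
derivatives are the ones without normalizing factors (no `1/2` in `dη`, no `1/3` in `dΦ`). -/

section Calculus

variable {E : Type*} [NormedAddCommGroup E] [NormedSpace ℝ E]
  {H : Type*} [TopologicalSpace H] (I : ModelWithCorners ℝ E H)
  {M : Type*} [TopologicalSpace M] [ChartedSpace H M] [IsManifold I ∞ M]

/-- `X ∈ 𝔛(M)`: a global smooth vector field. -/
def IsSmoothField (X : Π x : M, TangentSpace I x) : Prop :=
  ContMDiff I I.tangent ∞ (fun x ↦ (⟨x, X x⟩ : TangentBundle I M))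

/-- The derivative `X(f)` of a function `f` along a vector field `X`. -/
def dirDeriv (X : Π x : M, TangentSpace I x) (f : M → ℝ) (x : M) : ℝ :=
  mvfderiv I f x (X x)

/-- The vector field `φX`. -/
def applyEnd (φ : Π x : M, TangentSpace I x →L[ℝ] TangentSpace I x)
    (X : Π x : M, TangentSpace I x) : Π x : M, TangentSpace I x :=
  fun x ↦ φ x (X x)

/-- `dη(X,Y) = X(η(Y)) - Y(η(X)) - η([X,Y])`. -/
def extDerivOne (η : Π x : M, TangentSpace I x →L[ℝ] ℝ)
    (X Y : Π x : M, TangentSpace I x) (x : M) : ℝ :=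
  dirDeriv I X (fun y ↦ η y (Y y)) x - dirDeriv I Y (fun y ↦ η y (X y)) x
    - η x (VectorField.mlieBracket I X Y x)

/-- `dΩ(X,Y,Z) = X(Ω(Y,Z)) + Y(Ω(Z,X)) + Z(Ω(X,Y)) - Ω([X,Y],Z) - Ω([Y,Z],X) - Ω([Z,X],Y)`. -/
def extDerivTwo (Ω : Π x : M, TangentSpace I x → TangentSpace I x → ℝ)
    (X Y Z : Π x : M, TangentSpace I x) (x : M) : ℝ :=
  dirDeriv I X (fun y ↦ Ω y (Y y) (Z y)) x
    + dirDeriv I Y (fun y ↦ Ω y (Z y) (X y)) x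
    + dirDeriv I Z (fun y ↦ Ω y (X y) (Y y)) x
    - Ω x (VectorField.mlieBracket I X Y x) (Z x)
    - Ω x (VectorField.mlieBracket I Y Z x) (X x)
    - Ω x (VectorField.mlieBracket I Z X x) (Y x)

/-- The Lie derivative `(𝓛_ξ φ)X = [ξ, φX] - φ[ξ, X]` of an endomorphism field. -/
def lieDerivEnd (ξ : Π x : M, TangentSpace I x)
    (φ : Π x : M, TangentSpace I x →L[ℝ] TangentSpace I x)
    (X : Π x : M, TangentSpace I x) (x : M) : TangentSpace I x :=
  VectorField.mlieBracket I ξ (applyEnd I φ X) x - φ x (VectorField.mlieBracket I ξ X x)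

/-- `N_φ(X,Y) = [φX,φY] + φ²[X,Y] - φ[φX,Y] - φ[X,φY] + dη(X,Y)ξ`. -/
def nijenhuis (φ : Π x : M, TangentSpace I x →L[ℝ] TangentSpace I x)
    (ξ : Π x : M, TangentSpace I x) (η : Π x : M, TangentSpace I x →L[ℝ] ℝ)
    (X Y : Π x : M, TangentSpace I x) (x : M) : TangentSpace I x :=
  VectorField.mlieBracket I (applyEnd I φ X) (applyEnd I φ Y) x
    + φ x (φ x (VectorField.mlieBracket I X Y x))
    - φ x (VectorField.mlieBracket I (applyEnd I φ X) Y x)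
    - φ x (VectorField.mlieBracket I X (applyEnd I φ Y) x)
    + extDerivOne I η X Y x • ξ x

/-- `(∇_v φ)Y = ∇_v(φY) - φ(∇_v Y)` for a tangent vector `v` at `x`. -/
def covDerivEnd (cov : CovariantDerivative I E (TangentSpace I : M → Type _))
    (φ : Π x : M, TangentSpace I x →L[ℝ] TangentSpace I x)
    (Y : Π x : M, TangentSpace I x) (x : M) (v : TangentSpace I x) : TangentSpace I x :=
  cov (applyEnd I φ Y) x v - φ x (cov Y x v)

end Calculus

section Riemannian

variable {E : Type*} [NormedAddCommGroup E] [NormedSpace ℝ E]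
  {H : Type*} [TopologicalSpace H] (I : ModelWithCorners ℝ E H)
  {M : Type*} [TopologicalSpace M] [ChartedSpace H M] [IsManifold I ∞ M]
  (g : ContMDiffRiemannianMetric I ∞ E (fun x : M ↦ TangentSpace I x))

/-- The fundamental form `Φ(u,v) = g(u, φv)`. -/
def fundForm (φ : Π x : M, TangentSpace I x →L[ℝ] TangentSpace I x)
    (x : M) (u v : TangentSpace I x) : ℝ :=
  g.inner x u (φ x v)

/-- The Lie derivative `(𝓛_ξ g)(X,Y) = ξ(g(X,Y)) - g([ξ,X],Y) - g(X,[ξ,Y])` of the metric. -/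
def lieDerivMetric (ξ X Y : Π x : M, TangentSpace I x) (x : M) : ℝ :=
  dirDeriv I ξ (fun y ↦ g.inner y (X y) (Y y)) x
    - g.inner x (VectorField.mlieBracket I ξ X x) (Y x)
    - g.inner x (X x) (VectorField.mlieBracket I ξ Y x)

/-- `ξ` is a Killing vector field: `𝓛_ξ g = 0`. -/
def IsKilling (ξ : Π x : M, TangentSpace I x) : Prop :=
  ∀ X Y : Π x : M, TangentSpace I x, IsSmoothField I X → IsSmoothField I Y →
    ∀ x, lieDerivMetric I g ξ X Y x = 0

variable [FiniteDimensional ℝ E]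

/-- The torsion as a `(0,3)`-tensor, `T(u,v,w) = g(T(u,v), w)`. -/
def torsion₃ (cov : CovariantDerivative I E (TangentSpace I : M → Type _))
    (x : M) (u v w : TangentSpace I x) : ℝ :=
  g.inner x (cov.torsion x u v) w

/-- A smooth linear connection on `TM` that is metric and whose torsion `(0,3)`-tensor is
totally skew-symmetric. -/
structure IsMetricSkewTorsion
    (cov : CovariantDerivative I E (TangentSpace I : M → Type _)) : Prop where
  smooth : CovariantDerivative.ContMDiffCovariantDerivative cov ∞
  metric : ∀ X Y Z : Π x : M, TangentSpace I x,
    IsSmoothField I X → IsSmoothField I Y → IsSmoothField I Z → ∀ x,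
    dirDeriv I X (fun y ↦ g.inner y (Y y) (Z y)) x
      = g.inner x (cov Y x (X x)) (Z x) + g.inner x (Y x) (cov Z x (X x))
  skew₁₂ : ∀ (x : M) (u v w : TangentSpace I x),
    torsion₃ I g cov x u v w = -torsion₃ I g cov x v u w
  skew₂₃ : ∀ (x : M) (u v w : TangentSpace I x),
    torsion₃ I g cov x u v w = -torsion₃ I g cov x u w v

end Riemannian

/-! ### Almost 3-contact metric structures

Indices run through `Fin 3`; the even permutations of the three indices are exactly the triples
`(i, i + 1, i + 2)`. -/

/-- The totally skew-symmetric symbol `ε_{ijk}`. -/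
def epsilon (i j k : Fin 3) : ℝ :=
  if j = i + 1 ∧ k = i + 2 then 1 else if j = i + 2 ∧ k = i + 1 then -1 else 0

variable {E : Type*} [NormedAddCommGroup E] [NormedSpace ℝ E]
  {H : Type*} [TopologicalSpace H] (I : ModelWithCorners ℝ E H)
  (M : Type*) [TopologicalSpace M] [ChartedSpace H M] [IsManifold I ∞ M]

/-- An almost 3-contact metric structure `(φ_i, ξ_i, η_i, g)` on `M`, with `g` a smooth
Riemannian metric. -/
structure AlmostThreeContactMetric where
  g : ContMDiffRiemannianMetric I ∞ E (fun x : M ↦ TangentSpace I x)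
  φ : Fin 3 → Π x : M, TangentSpace I x →L[ℝ] TangentSpace I x
  ξ : Fin 3 → Π x : M, TangentSpace I x
  η : Fin 3 → Π x : M, TangentSpace I x →L[ℝ] ℝ
  smooth_φ : ∀ i, ContMDiff I (I.prod 𝓘(ℝ, E →L[ℝ] E)) ∞
    (fun x ↦ TotalSpace.mk' (E →L[ℝ] E)
      (E := fun x : M ↦ TangentSpace I x →L[ℝ] TangentSpace I x) x (φ i x))
  smooth_ξ : ∀ i, IsSmoothField I (ξ i)
  smooth_η : ∀ i, ContMDiff I (I.prod 𝓘(ℝ, E →L[ℝ] ℝ)) ∞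
    (fun x ↦ TotalSpace.mk' (E →L[ℝ] ℝ)
      (E := fun x : M ↦ TangentSpace I x →L[ℝ] Bundle.Trivial M ℝ x) x (η i x))
  /-- `φ_i² = -I + η_i ⊗ ξ_i` -/
  φ_sq : ∀ i x (v : TangentSpace I x), φ i x (φ i x v) = -v + η i x v • ξ i x
  η_ξ : ∀ i x, η i x (ξ i x) = 1
  /-- `φ_k = φ_i φ_j - η_j ⊗ ξ_i` -/
  φ_eq₁ : ∀ i x (v : TangentSpace I x),
    φ (i + 2) x v = φ i x (φ (i + 1) x v) - η (i + 1) x v • ξ i x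
  /-- `φ_k = -φ_j φ_i + η_i ⊗ ξ_j` -/
  φ_eq₂ : ∀ i x (v : TangentSpace I x),
    φ (i + 2) x v = -φ (i + 1) x (φ i x v) + η i x v • ξ (i + 1) x
  /-- `ξ_k = φ_i ξ_j` -/
  ξ_eq₁ : ∀ i x, ξ (i + 2) x = φ i x (ξ (i + 1) x)
  /-- `ξ_k = -φ_j ξ_i` -/
  ξ_eq₂ : ∀ i x, ξ (i + 2) x = -φ (i + 1) x (ξ i x)
  /-- `η_k = η_i ∘ φ_j` -/
  η_eq₁ : ∀ i x (v : TangentSpace I x), η (i + 2) x v = η i x (φ (i + 1) x v)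
  /-- `η_k = -η_j ∘ φ_i` -/
  η_eq₂ : ∀ i x (v : TangentSpace I x), η (i + 2) x v = -η (i + 1) x (φ i x v)
  /-- `g(φ_i u, φ_i v) = g(u, v) - η_i(u) η_i(v)` -/
  compatible : ∀ i x (u v : TangentSpace I x),
    g.inner x (φ i x u) (φ i x v) = g.inner x u v - η i x u * η i x v

namespace AlmostThreeContactMetric

variable {I M}
variable (S : AlmostThreeContactMetric I M)

/-- `X ∈ Γ(𝓗)`, with `𝓗 = ⋂ ker η_i`: a smooth horizontal vector field. -/
def IsHorizontal (X : Π x : M, TangentSpace I x) : Prop :=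
  IsSmoothField I X ∧ ∀ i x, S.η i x (X x) = 0

/-- `X ∈ Γ(𝓥)`, with `𝓥 = ⟨ξ₁, ξ₂, ξ₃⟩`: a smooth vertical vector field. -/
def IsVertical (X : Π x : M, TangentSpace I x) : Prop :=
  IsSmoothField I X ∧ ∀ x, X x ∈ Submodule.span ℝ (Set.range fun i ↦ S.ξ i x)

/-- `φ_a = a₁φ₁ + a₂φ₂ + a₃φ₃`. -/
def φSphere (a : Fin 3 → ℝ) (x : M) : TangentSpace I x →L[ℝ] TangentSpace I x :=
  ∑ i, a i • S.φ i x

/-- `ξ_a = a₁ξ₁ + a₂ξ₂ + a₃ξ₃`. -/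
def ξSphere (a : Fin 3 → ℝ) (x : M) : TangentSpace I x :=
  ∑ i, a i • S.ξ i x

/-- `η_a = a₁η₁ + a₂η₂ + a₃η₃`. -/
def ηSphere (a : Fin 3 → ℝ) (x : M) : TangentSpace I x →L[ℝ] ℝ :=
  ∑ i, a i • S.η i x

/-- `N_{φ_i}(X,Y,Z) = g(N_{φ_i}(X,Y), Z)`. -/
def N (i : Fin 3) (X Y Z : Π x : M, TangentSpace I x) (x : M) : ℝ :=
  S.g.inner x (nijenhuis I (S.φ i) (S.ξ i) (S.η i) X Y x) (Z x)

/-- `N_{φ_i}` is a 3-form on `𝓗`. -/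
def NSkewOnHorizontal (i : Fin 3) : Prop :=
  ∀ X Y Z : Π x : M, TangentSpace I x, S.IsHorizontal X → S.IsHorizontal Y → S.IsHorizontal Z →
    ∀ x, S.N i X Y Z x = -S.N i Y X Z x ∧ S.N i X Y Z x = -S.N i X Z Y x

/-- `A_{ij}(X,Y) = g((𝓛_{ξ_j} φ_i)X, Y) + dη_j(X, φ_i Y) + dη_j(φ_i X, Y)`. -/
def A (i j : Fin 3) (X Y : Π x : M, TangentSpace I x) (x : M) : ℝ :=
  S.g.inner x (lieDerivEnd I (S.ξ j) (S.φ i) X x) (Y x)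
    + extDerivOne I (S.η j) X (applyEnd I (S.φ i) Y) x
    + extDerivOne I (S.η j) (applyEnd I (S.φ i) X) Y x

/-- `β` is a Reeb Killing function: `A_{ii} = 0` and `A_{ij} = -A_{ji} = βΦ_k` on `𝓗` for every
even permutation `(i,j,k)`. -/
structure IsReebKillingFunction (β : M → ℝ) : Prop where
  smooth : ContMDiff I 𝓘(ℝ) ∞ β
  diag : ∀ i, ∀ X Y : Π x : M, TangentSpace I x, S.IsHorizontal X → S.IsHorizontal Y →
    ∀ x, S.A i i X Y x = 0
  offDiag : ∀ i, ∀ X Y : Π x : M, TangentSpace I x, S.IsHorizontal X → S.IsHorizontal Y →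
    ∀ x, S.A i (i + 1) X Y x = β x * fundForm I S.g (S.φ (i + 2)) x (X x) (Y x) ∧
      -S.A (i + 1) i X Y x = β x * fundForm I S.g (S.φ (i + 2)) x (X x) (Y x)

/-- `δ` is a Reeb commutator function: `η_k([ξ_i, ξ_j]) = 2δ ε_{ijk}`. -/
structure IsReebCommutatorFunction (δ : M → ℝ) : Prop where
  smooth : ContMDiff I 𝓘(ℝ) ∞ δ
  bracket : ∀ i j k x,
    S.η k x (VectorField.mlieBracket I (S.ξ i) (S.ξ j) x) = 2 * δ x * epsilon i j k

/-- Canonical almost 3-contact metric manifolds. -/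
structure IsCanonical : Prop where
  skew : ∀ i, S.NSkewOnHorizontal i
  killing : ∀ i, IsKilling I S.g (S.ξ i)
  independent : ∀ i j, ∀ X Y Z : Π x : M, TangentSpace I x,
    S.IsHorizontal X → S.IsHorizontal Y → S.IsHorizontal Z → ∀ x,
    S.N i X Y Z x - extDerivTwo I (fundForm I S.g (S.φ i))
        (applyEnd I (S.φ i) X) (applyEnd I (S.φ i) Y) (applyEnd I (S.φ i) Z) x
      = S.N j X Y Z x - extDerivTwo I (fundForm I S.g (S.φ j))
        (applyEnd I (S.φ j) X) (applyEnd I (S.φ j) Y) (applyEnd I (S.φ j) Z) x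
  reebKilling : ∃ β, S.IsReebKillingFunction β

variable [FiniteDimensional ℝ E]

/-- `∇` is a `φ_a`-compatible connection: a metric connection with skew torsion that preserves
`TM = 𝓗 ⊕ 𝓥` and satisfies `(∇_X φ_a)Y = 0` for all horizontal `X`, `Y`. -/
structure IsCompatibleConnection (a : Fin 3 → ℝ)
    (cov : CovariantDerivative I E (TangentSpace I : M → Type _)) : Prop where
  metricSkew : IsMetricSkewTorsion I S.g cov
  horizontal : ∀ X Y : Π x : M, TangentSpace I x, IsSmoothField I X → S.IsHorizontal Y →
    S.IsHorizontal (fun x ↦ cov Y x (X x))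
  vertical : ∀ X Y : Π x : M, TangentSpace I x, IsSmoothField I X → S.IsVertical Y →
    S.IsVertical (fun x ↦ cov Y x (X x))
  parallel : ∀ X Y : Π x : M, TangentSpace I x, S.IsHorizontal X → S.IsHorizontal Y →
    ∀ x, covDerivEnd I cov (S.φSphere a) Y x (X x) = 0

/-- `∇` is a metric connection with skew torsion, `β` is smooth, and
`∇_X φ_i = β(η_k(X)φ_j - η_j(X)φ_k)` for every even permutation `(i,j,k)`. -/
structure IsCanonicalConnection
    (cov : CovariantDerivative I E (TangentSpace I : M → Type _)) (β : M → ℝ) : Prop where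
  metricSkew : IsMetricSkewTorsion I S.g cov
  smooth : ContMDiff I 𝓘(ℝ) ∞ β
  deriv_φ : ∀ i, ∀ X Y : Π x : M, TangentSpace I x, IsSmoothField I X → IsSmoothField I Y →
    ∀ x, covDerivEnd I cov (S.φ i) Y x (X x) =
      β x • (S.η (i + 2) x (X x) • S.φ (i + 1) x (Y x)
        - S.η (i + 1) x (X x) • S.φ (i + 2) x (Y x))

/-- The formulas for the torsion `T` of `∇` with respect to `φ = φ_a`: for horizontal `X, Y, Z`,
`T(X,Y,Z) = N_φ(X,Y,Z) - dΦ(φX,φY,φZ)`, `T(X,Y,ξ_i) = dη_i(X,Y)` and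
`T(X,ξ_i,ξ_j) = -g([ξ_i,ξ_j],X)`. -/
structure TorsionFormulas (a : Fin 3 → ℝ)
    (cov : CovariantDerivative I E (TangentSpace I : M → Type _)) : Prop where
  horizontal : ∀ X Y Z : Π x : M, TangentSpace I x,
    S.IsHorizontal X → S.IsHorizontal Y → S.IsHorizontal Z → ∀ x,
    torsion₃ I S.g cov x (X x) (Y x) (Z x) =
      S.g.inner x (nijenhuis I (S.φSphere a) (S.ξSphere a) (S.ηSphere a) X Y x) (Z x)
        - extDerivTwo I (fundForm I S.g (S.φSphere a)) (applyEnd I (S.φSphere a) X)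
          (applyEnd I (S.φSphere a) Y) (applyEnd I (S.φSphere a) Z) x
  mixed₁ : ∀ i, ∀ X Y : Π x : M, TangentSpace I x, S.IsHorizontal X → S.IsHorizontal Y →
    ∀ x, torsion₃ I S.g cov x (X x) (Y x) (S.ξ i x) = extDerivOne I (S.η i) X Y x
  mixed₂ : ∀ i j, ∀ X : Π x : M, TangentSpace I x, S.IsHorizontal X →
    ∀ x, torsion₃ I S.g cov x (X x) (S.ξ i x) (S.ξ j x) =
      -S.g.inner x (VectorField.mlieBracket I (S.ξ i) (S.ξ j) x) (X x)

end AlmostThreeContactMetric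

end ThreeContact

end

noncomputable section

namespace ThreeContact

open VectorField Filter Topology Module

section SmoothFields

variable {E : Type*} [NormedAddCommGroup E] [NormedSpace ℝ E]
  {H : Type*} [TopologicalSpace H] {I : ModelWithCorners ℝ E H}
  {M : Type*} [TopologicalSpace M] [ChartedSpace H M] [IsManifold I ∞ M]

lemma IsSmoothField.mdifferentiableAt {X : Π x : M, TangentSpace I x} (hX : IsSmoothField I X)
    (x : M) : MDiffAt (T% X) x :=
  (hX x).mdifferentiableAt (by simp)

lemma IsSmoothField.sub {X Y : Π x : M, TangentSpace I x} (hX : IsSmoothField I X)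
    (hY : IsSmoothField I Y) : IsSmoothField I (X - Y) :=
  ContMDiff.sub_section hX hY

lemma IsSmoothField.smul {f : M → ℝ} {X : Π x : M, TangentSpace I x}
    (hf : ContMDiff I 𝓘(ℝ) ∞ f) (hX : IsSmoothField I X) : IsSmoothField I (f • X) :=
  ContMDiff.smul_section hf hX

lemma IsSmoothField.const_smul (a : ℝ) {X : Π x : M, TangentSpace I x}
    (hX : IsSmoothField I X) : IsSmoothField I (a • X) :=
  ContMDiff.const_smul_section hX

lemma IsSmoothField.sum {ι : Type*} {s : Finset ι} {X : ι → Π x : M, TangentSpace I x}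
    (hX : ∀ i ∈ s, IsSmoothField I (X i)) : IsSmoothField I (fun x ↦ ∑ i ∈ s, X i x) :=
  ContMDiff.sum_section hX

/-- A smooth field of endomorphisms of the tangent bundle. -/
def IsSmoothEnd (φ : Π x : M, TangentSpace I x →L[ℝ] TangentSpace I x) : Prop :=
  ContMDiff I (I.prod 𝓘(ℝ, E →L[ℝ] E)) ∞
    (fun x ↦ TotalSpace.mk' (E →L[ℝ] E)
      (E := fun x : M ↦ TangentSpace I x →L[ℝ] TangentSpace I x) x (φ x))

/-- A smooth one-form. -/
def IsSmoothForm (η : Π x : M, TangentSpace I x →L[ℝ] ℝ) : Prop :=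
  ContMDiff I (I.prod 𝓘(ℝ, E →L[ℝ] ℝ)) ∞
    (fun x ↦ TotalSpace.mk' (E →L[ℝ] ℝ)
      (E := fun x : M ↦ TangentSpace I x →L[ℝ] Bundle.Trivial M ℝ x) x (η x))

lemma IsSmoothEnd.apply {φ : Π x : M, TangentSpace I x →L[ℝ] TangentSpace I x}
    (hφ : IsSmoothEnd φ) {X : Π x : M, TangentSpace I x} (hX : IsSmoothField I X) :
    IsSmoothField I (fun x ↦ φ x (X x)) :=
  ContMDiff.clm_bundle_apply (F₁ := E) (F₂ := E) (b := fun x ↦ x) hφ hX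

lemma IsSmoothEnd.applyEnd {φ : Π x : M, TangentSpace I x →L[ℝ] TangentSpace I x}
    (hφ : IsSmoothEnd φ) {X : Π x : M, TangentSpace I x} (hX : IsSmoothField I X) :
    IsSmoothField I (applyEnd I φ X) := hφ.apply hX

lemma IsSmoothForm.apply {η : Π x : M, TangentSpace I x →L[ℝ] ℝ}
    (hη : IsSmoothForm η) {X : Π x : M, TangentSpace I x} (hX : IsSmoothField I X) :
    ContMDiff I 𝓘(ℝ) ∞ (fun x ↦ η x (X x)) := by
  intro x
  have := (ContMDiff.clm_bundle_apply (F₁ := E) (F₂ := ℝ) (b := fun x ↦ x) hη hX) x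
  exact contMDiffAt_section x |>.1 this

lemma contMDiff_inner (g : ContMDiffRiemannianMetric I ∞ E (fun x : M ↦ TangentSpace I x))
    {X Y : Π x : M, TangentSpace I x} (hX : IsSmoothField I X) (hY : IsSmoothField I Y) :
    ContMDiff I 𝓘(ℝ) ∞ (fun x ↦ g.inner x (X x) (Y x)) := by
  intro x
  have := (ContMDiff.clm_bundle_apply₂ (F₁ := E) (F₂ := E) (F₃ := ℝ) (b := fun x ↦ x)
    (E₃ := Bundle.Trivial M ℝ) g.contMDiff hX hY) x
  exact contMDiffAt_section x |>.1 this

lemma mdifferentiableAt_inner (g : ContMDiffRiemannianMetric I ∞ E (fun x : M ↦ TangentSpace I x))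
    {X Y : Π x : M, TangentSpace I x} {x : M} (hX : MDiffAt (T% X) x) (hY : MDiffAt (T% Y) x) :
    MDiffAt (fun x ↦ g.inner x (X x) (Y x)) x := by
  have := MDifferentiableAt.clm_bundle_apply₂ (F₁ := E) (F₂ := E) (F₃ := ℝ) (b := fun x ↦ x)
    (E₃ := Bundle.Trivial M ℝ) ((g.contMDiff x).mdifferentiableAt (by simp)) hX hY
  exact mdifferentiableAt_section I (fun x ↦ g.inner x (X x) (Y x)) |>.1 this

lemma eq_of_inner_eq (g : ContMDiffRiemannianMetric I ∞ E (fun x : M ↦ TangentSpace I x))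
    {x : M} {u v : TangentSpace I x}
    (h : ∀ w, g.inner x u w = g.inner x v w) : u = v := by
  by_contra hne
  have h1 := g.pos x (u - v) (sub_ne_zero.2 hne)
  have h2 : g.inner x (u - v) (u - v) = 0 := by
    rw [map_sub (g.inner x), sub_apply, h, sub_self]
  exact h1.ne' h2

lemma IsSmoothField.mlieBracket [CompleteSpace E] {X Y : Π x : M, TangentSpace I x}
    (hX : IsSmoothField I X)
    (hY : IsSmoothField I Y) : IsSmoothField I (mlieBracket I X Y) := by
  have : IsManifold I ((⊤ : ℕ∞) + 1) M := by simpa using ‹IsManifold I ∞ M›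
  have : IsManifold I (minSmoothness ℝ 2) M := by
    rw [minSmoothness_of_isRCLikeNormedField]; infer_instance
  exact ContDiff.mlieBracket_vectorField (m := ⊤) (n := ⊤) hX hY (by simp)

lemma contMDiff_dirDeriv {X : Π x : M, TangentSpace I x} (hX : IsSmoothField I X) {f : M → ℝ}
    (hf : ContMDiff I 𝓘(ℝ) ∞ f) : ContMDiff I 𝓘(ℝ) ∞ (dirDeriv I X f) := by
  have h1 := (hf.contMDiff_tangentMap (m := ∞) (by simp)).comp hX
  exact (contMDiff_snd_tangentBundle_modelSpace ℝ 𝓘(ℝ)).comp h1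

end SmoothFields

section SmoothMatrices

variable {E : Type*} [NormedAddCommGroup E] [NormedSpace ℝ E]
  {H : Type*} [TopologicalSpace H] {I : ModelWithCorners ℝ E H}
  {M : Type*} [TopologicalSpace M] [ChartedSpace H M]

lemma contMDiffAt_clm_of_basis {ι : Type*} [Fintype ι] [FiniteDimensional ℝ E] (b : Basis ι ℝ E)
    {F : Type*}
    [NormedAddCommGroup F] [NormedSpace ℝ F] {f : M → E →L[ℝ] F} {x₀ : M}
    (h : ∀ a, ContMDiffAt I 𝓘(ℝ, F) ∞ (fun x ↦ f x (b a)) x₀) :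
    ContMDiffAt I 𝓘(ℝ, E →L[ℝ] F) ∞ f x₀ := by
  have key : f = fun x ↦ ∑ a, ContinuousLinearMap.smulRightL ℝ E F
      (LinearMap.toContinuousLinearMap (b.coord a)) (f x (b a)) := by
    ext x v
    conv_lhs => rw [← b.sum_repr v]
    simp only [map_sum, map_smul]
    simp
  rw [key]
  refine ContMDiffAt.sum fun a _ ↦ ?_
  exact (ContinuousLinearMap.contMDiff _).contMDiffAt.comp x₀ (h a)

lemma contMDiffAt_matrix_det {ι : Type*} [Fintype ι] [DecidableEq ι] {A : M → Matrix ι ι ℝ} {x₀ : M}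
    (hA : ∀ i j, ContMDiffAt I 𝓘(ℝ) ∞ (fun x ↦ A x i j) x₀) :
    ContMDiffAt I 𝓘(ℝ) ∞ (fun x ↦ (A x).det) x₀ := by
  simp only [Matrix.det_apply']
  refine ContMDiffAt.sum fun σ _ ↦ ?_
  refine contMDiffAt_const.mul ?_
  exact ContMDiffAt.prod fun i _ ↦ hA _ _

lemma contMDiffAt_matrix_adjugate {ι : Type*} [Fintype ι] [DecidableEq ι] {A : M → Matrix ι ι ℝ}
    {x₀ : M} (hA : ∀ i j, ContMDiffAt I 𝓘(ℝ) ∞ (fun x ↦ A x i j) x₀) (i j : ι) :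
    ContMDiffAt I 𝓘(ℝ) ∞ (fun x ↦ (A x).adjugate i j) x₀ := by
  simp only [Matrix.adjugate_apply]
  refine contMDiffAt_matrix_det fun k l ↦ ?_
  simp only [Matrix.updateRow_apply]
  split_ifs
  · exact contMDiffAt_const
  · exact hA k l

end SmoothMatrices

section GlobalExtension

variable {E : Type*} [NormedAddCommGroup E] [NormedSpace ℝ E] [FiniteDimensional ℝ E]
  {H : Type*} [TopologicalSpace H] {I : ModelWithCorners ℝ E H}
  {M : Type*} [TopologicalSpace M] [ChartedSpace H M] [IsManifold I ∞ M] [T2Space M]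

/-- Near every point the tangent bundle has a frame of globally defined smooth vector fields, given
by a basis of the model space read in the trivialization at that point. -/
lemma exists_smooth_frame {ι : Type*} (b : Basis ι ℝ E) (x₀ : M) :
    ∃ e : ι → Π x : M, TangentSpace I x, (∀ a, IsSmoothField I (e a)) ∧
      ∀ᶠ x in 𝓝 x₀, ∃ hx : x ∈ (trivializationAt E (TangentSpace I : M → Type _) x₀).baseSet,
        ∀ a, e a x = (trivializationAt E (TangentSpace I : M → Type _) x₀).basisAt b hx a := by
  set t := trivializationAt E (TangentSpace I : M → Type _) x₀
  have hx₀ : x₀ ∈ t.baseSet := mem_baseSet_trivializationAt E (TangentSpace I) x₀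
  obtain ⟨f, -, hf⟩ := (SmoothBumpFunction.nhds_basis_tsupport (I := I) x₀).mem_iff.1
    (t.open_baseSet.mem_nhds hx₀)
  refine ⟨fun a ↦ (f : M → ℝ) • t.localFrame b a, fun a ↦ ?_, ?_⟩
  · have := ContMDiffOn.smul_section_of_tsupport (n := ∞) (u := t.baseSet)
      (V := (TangentSpace I : M → Type _)) (F := E)
      (f.contMDiff.contMDiffOn) t.open_baseSet hf (t.contMDiffOn_localFrame_baseSet (I := I) ∞ b a)
    exact this
  · filter_upwards [f.eventuallyEq_one, t.open_baseSet.mem_nhds hx₀] with x h1 h2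
    refine ⟨h2, fun a ↦ ?_⟩
    simp [h1, t.localFrame_apply_of_mem_baseSet b h2]
    rfl

lemma exists_smoothField_eq (x : M) (v : TangentSpace I x) :
    ∃ X : Π x : M, TangentSpace I x, IsSmoothField I X ∧ X x = v := by
  obtain ⟨e, he, h⟩ := exists_smooth_frame (I := I) (Module.finBasis ℝ E) x
  obtain ⟨hx, h⟩ := h.self_of_nhds
  refine ⟨fun y ↦ ∑ a, ((Trivialization.basisAt _ (Module.finBasis ℝ E) hx).repr v a) • e a y,
    IsSmoothField.sum fun a _ ↦ (he a).const_smul _, ?_⟩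
  simp only [h, Basis.sum_repr]

lemma isSmoothEnd_of_apply {φ : Π x : M, TangentSpace I x →L[ℝ] TangentSpace I x}
    (h : ∀ X : Π x : M, TangentSpace I x, IsSmoothField I X →
      IsSmoothField I (fun x ↦ φ x (X x))) : IsSmoothEnd φ := by
  intro x₀
  rw [contMDiffAt_hom_bundle]
  refine ⟨contMDiffAt_id, ?_⟩
  let b := Module.finBasis ℝ E
  obtain ⟨e, he, hb⟩ := exists_smooth_frame (I := I) b x₀
  refine contMDiffAt_clm_of_basis b fun a ↦ ?_
  have h1 := (contMDiffAt_section x₀).1 (h _ (he a) x₀)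
  refine h1.congr_of_eventuallyEq ?_
  filter_upwards [hb] with x ⟨hx, hx'⟩
  rw [ContinuousLinearMap.inCoordinates_eq hx hx, hx' a]
  rfl

/-- A vector field is smooth as soon as its inner products with smooth fields are. -/
lemma isSmoothField_of_inner (g : ContMDiffRiemannianMetric I ∞ E (fun x : M ↦ TangentSpace I x))
    {W : Π x : M, TangentSpace I x}
    (h : ∀ Z : Π x : M, TangentSpace I x, IsSmoothField I Z →
      ContMDiff I 𝓘(ℝ) ∞ (fun x ↦ g.inner x (W x) (Z x))) : IsSmoothField I W := by
  intro x₀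
  let b := Module.finBasis ℝ E
  obtain ⟨e, he, hb⟩ := exists_smooth_frame (I := I) b x₀
  let G : M → Matrix _ _ ℝ := fun x ↦ Matrix.of fun a c ↦ g.inner x (e a x) (e c x)
  have hG : ∀ a c, ContMDiffAt I 𝓘(ℝ) ∞ (fun x ↦ G x a c) x₀ :=
    fun a c ↦ contMDiff_inner g (he a) (he c) x₀
  have hdet : ∀ᶠ x in 𝓝 x₀, (G x).det ≠ 0 := by
    filter_upwards [hb] with x ⟨hx, hx'⟩ h0
    obtain ⟨v, hv0, hv⟩ := Matrix.exists_vecMul_eq_zero_iff.2 h0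
    have h1 : g.inner x (∑ a, v a • e a x) (∑ a, v a • e a x) = 0 := by
      simp only [map_sum, map_smul, sum_apply, smul_eq_mul,
        smul_apply]
      refine Finset.sum_eq_zero fun c _ ↦ ?_
      have := congrFun hv c
      simp only [Matrix.vecMul, dotProduct, Pi.zero_apply] at this
      rw [show (∑ d, v d * g.inner x (e d x) (e c x)) = 0 from this, mul_zero]
    have h2 : ∑ a, v a • e a x = 0 := by
      by_contra hne
      exact (g.pos x _ hne).ne' h1
    simp only [hx'] at h2
    exact hv0 (funext fun a ↦ Fintype.linearIndependent_iff.1 (Basis.linearIndependent _) v h2 a)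
  let w : _ → M → ℝ := fun a x ↦ ∑ c, g.inner x (W x) (e c x) * ((G x).det⁻¹ * (G x).adjugate c a)
  have hw : ∀ a, ContMDiffAt I 𝓘(ℝ) ∞ (w a) x₀ := fun a ↦ ContMDiffAt.sum fun c _ ↦
    (h _ (he c) x₀).mul (((contMDiffAt_matrix_det hG).inv₀ hdet.self_of_nhds).mul
      (contMDiffAt_matrix_adjugate hG c a))
  have hsum : ContMDiffAt I I.tangent ∞
      (fun x ↦ (⟨x, ∑ a, w a x • e a x⟩ : TangentBundle I M)) x₀ :=
    ContMDiffAt.sum_section fun a _ ↦ (hw a).smul_section (he a x₀)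
  refine hsum.congr_of_eventuallyEq ?_
  filter_upwards [hb, hdet] with x ⟨hx, hx'⟩ hd
  congr 1
  set B := (trivializationAt E (TangentSpace I : M → Type _) x₀).basisAt b hx
  have hW : W x = ∑ a, B.repr (W x) a • e a x := by
    simp only [hx']; exact (B.sum_repr (W x)).symm
  have hvec : Matrix.vecMul (B.repr (W x)) (G x) = fun c ↦ g.inner x (W x) (e c x) := by
    ext c
    conv_rhs => rw [hW]
    simp [Matrix.vecMul, dotProduct, G]
  have hsol : ∀ a, w a x = B.repr (W x) a := by
    intro a
    have h3 : Matrix.vecMul (Matrix.vecMul (B.repr (W x)) (G x)) ((G x).det⁻¹ • (G x).adjugate)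
        = B.repr (W x) := by
      rw [Matrix.vecMul_vecMul, Matrix.mul_smul, Matrix.mul_adjugate, smul_smul,
        inv_mul_cancel₀ hd, one_smul, Matrix.vecMul_one]
    rw [hvec] at h3
    exact congrFun h3 a
  simp only [hsol]
  exact hW

end GlobalExtension

section DirDeriv

variable {E : Type*} [NormedAddCommGroup E] [NormedSpace ℝ E]
  {H : Type*} [TopologicalSpace H] {I : ModelWithCorners ℝ E H}
  {M : Type*} [TopologicalSpace M] [ChartedSpace H M]
  {X Y Z : Π x : M, TangentSpace I x} {f h : M → ℝ} {x : M}

lemma dirDeriv_smul_left : dirDeriv I (f • X) h x = f x * dirDeriv I X h x := by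
  simp [dirDeriv]

lemma dirDeriv_add_left : dirDeriv I (X + Y) h x = dirDeriv I X h x + dirDeriv I Y h x := by
  simp [dirDeriv]

lemma dirDeriv_add (hf : MDiffAt f x) (hh : MDiffAt h x) :
    dirDeriv I X (fun y ↦ f y + h y) x = dirDeriv I X f x + dirDeriv I X h x := by
  simp [dirDeriv, mvfderiv_fun_add hf hh]

lemma dirDeriv_mul (hf : MDiffAt f x) (hh : MDiffAt h x) :
    dirDeriv I X (fun y ↦ f y * h y) x = f x * dirDeriv I X h x + dirDeriv I X f x * h x := by
  simp [dirDeriv, mvfderiv_fun_mul hf hh, mul_comm]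

end DirDeriv

section LeviCivita

variable {E : Type*} [NormedAddCommGroup E] [NormedSpace ℝ E]
  {H : Type*} [TopologicalSpace H] {I : ModelWithCorners ℝ E H}
  {M : Type*} [TopologicalSpace M] [ChartedSpace H M] [IsManifold I ∞ M]
  (g : ContMDiffRiemannianMetric I ∞ E (fun x : M ↦ TangentSpace I x))

/-- The right-hand side of the Koszul formula for `2 g(∇_X Y, Z)`. -/
def koszul (Y X Z : Π x : M, TangentSpace I x) (x : M) : ℝ :=
  dirDeriv I X (fun y ↦ g.inner y (Y y) (Z y)) x
    + dirDeriv I Y (fun y ↦ g.inner y (Z y) (X y)) x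
    - dirDeriv I Z (fun y ↦ g.inner y (X y) (Y y)) x
    + g.inner x (mlieBracket I X Y x) (Z x)
    - g.inner x (mlieBracket I Y Z x) (X x)
    + g.inner x (mlieBracket I Z X x) (Y x)

variable {g} {X X' Y Y' Z Z' : Π x : M, TangentSpace I x} {f : M → ℝ} {x : M}

lemma koszul_add_koszul_swap :
    koszul g Y X Z x + koszul g Z X Y x = 2 * dirDeriv I X (fun y ↦ g.inner y (Y y) (Z y)) x := by
  have h1 : ∀ U V : Π x : M, TangentSpace I x, (fun y ↦ g.inner y (U y) (V y))
      = fun y ↦ g.inner y (V y) (U y) := fun U V ↦ funext fun y ↦ g.symm y _ _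
  simp only [koszul]
  rw [h1 X Y, h1 X Z, h1 Z Y, mlieBracket_swap_apply (V := X) (W := Z),
    mlieBracket_swap_apply (V := Z) (W := Y), mlieBracket_swap_apply (V := Y) (W := X)]
  simp only [map_neg, neg_apply]
  ring

lemma koszul_sub_koszul_swap :
    koszul g Y X Z x - koszul g X Y Z x = 2 * g.inner x (mlieBracket I X Y x) (Z x) := by
  have h1 : ∀ U V : Π x : M, TangentSpace I x, (fun y ↦ g.inner y (U y) (V y))
      = fun y ↦ g.inner y (V y) (U y) := fun U V ↦ funext fun y ↦ g.symm y _ _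
  simp only [koszul]
  rw [h1 X Y, h1 X Z, h1 Z Y, mlieBracket_swap_apply (V := X) (W := Z),
    mlieBracket_swap_apply (V := Z) (W := Y), mlieBracket_swap_apply (V := Y) (W := X)]
  simp only [map_neg, neg_apply]
  ring

variable [FiniteDimensional ℝ E]

lemma koszul_smul_left (hf : MDiffAt f x) (hX : MDiffAt (T% X) x) (hY : MDiffAt (T% Y) x)
    (hZ : MDiffAt (T% Z) x) : koszul g Y (f • X) Z x = f x * koszul g Y X Z x := by
  have h1 := dirDeriv_mul (X := Y) hf (mdifferentiableAt_inner g hZ hX)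
  have h2 := dirDeriv_mul (X := Z) hf (mdifferentiableAt_inner g hX hY)
  simp only [koszul, dirDeriv_smul_left, Pi.smul_apply', map_smul, smul_eq_mul, smul_apply, h1, h2,
    mlieBracket_smul_left hf hX, mlieBracket_smul_right hf hX, map_add, add_apply]
  simp only [dirDeriv]
  rw [g.symm x (X x) (Z x), g.symm x (X x) (Y x)]
  ring

lemma koszul_add_left (hX : MDiffAt (T% X) x) (hX' : MDiffAt (T% X') x) (hY : MDiffAt (T% Y) x)
    (hZ : MDiffAt (T% Z) x) : koszul g Y (X + X') Z x = koszul g Y X Z x + koszul g Y X' Z x := by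
  have h1 := dirDeriv_add (X := Y) (mdifferentiableAt_inner g hZ hX)
    (mdifferentiableAt_inner g hZ hX')
  have h2 := dirDeriv_add (X := Z) (mdifferentiableAt_inner g hX hY)
    (mdifferentiableAt_inner g hX' hY)
  simp only [koszul, dirDeriv_add_left, Pi.add_apply, h1, h2,
    mlieBracket_add_left hX hX', mlieBracket_add_right hX hX', map_add, add_apply]
  ring

lemma koszul_smul_right (hf : MDiffAt f x) (hX : MDiffAt (T% X) x) (hY : MDiffAt (T% Y) x)
    (hZ : MDiffAt (T% Z) x) : koszul g Y X (f • Z) x = f x * koszul g Y X Z x := by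
  have h1 := dirDeriv_mul (X := Y) hf (mdifferentiableAt_inner g hZ hX)
  have h2 := dirDeriv_mul (X := X) hf (mdifferentiableAt_inner g hY hZ)
  simp only [koszul, dirDeriv_smul_left, Pi.smul_apply', map_smul, smul_eq_mul, smul_apply, h1, h2,
    mlieBracket_smul_left hf hZ, mlieBracket_smul_right hf hZ, map_add, add_apply]
  simp only [dirDeriv]
  rw [g.symm x (Z x) (X x), g.symm x (Z x) (Y x)]
  ring

lemma koszul_add_right (hX : MDiffAt (T% X) x) (hY : MDiffAt (T% Y) x)
    (hZ : MDiffAt (T% Z) x) (hZ' : MDiffAt (T% Z') x) :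
    koszul g Y X (Z + Z') x = koszul g Y X Z x + koszul g Y X Z' x := by
  have h1 := dirDeriv_add (X := Y) (mdifferentiableAt_inner g hZ hX)
    (mdifferentiableAt_inner g hZ' hX)
  have h2 := dirDeriv_add (X := X) (mdifferentiableAt_inner g hY hZ)
    (mdifferentiableAt_inner g hY hZ')
  simp only [koszul, dirDeriv_add_left, Pi.add_apply, h1, h2,
    mlieBracket_add_left hZ hZ', mlieBracket_add_right hZ hZ', map_add, add_apply]
  ring

lemma koszul_add (hX : MDiffAt (T% X) x) (hY : MDiffAt (T% Y) x) (hY' : MDiffAt (T% Y') x)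
    (hZ : MDiffAt (T% Z) x) : koszul g (Y + Y') X Z x = koszul g Y X Z x + koszul g Y' X Z x := by
  have h1 := dirDeriv_add (X := X) (mdifferentiableAt_inner g hY hZ)
    (mdifferentiableAt_inner g hY' hZ)
  have h2 := dirDeriv_add (X := Z) (mdifferentiableAt_inner g hX hY)
    (mdifferentiableAt_inner g hX hY')
  simp only [koszul, dirDeriv_add_left, Pi.add_apply, h1, h2,
    mlieBracket_add_left hY hY', mlieBracket_add_right hY hY', map_add, add_apply]
  ring

lemma koszul_smul (hf : MDiffAt f x) (hX : MDiffAt (T% X) x) (hY : MDiffAt (T% Y) x)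
    (hZ : MDiffAt (T% Z) x) : koszul g (f • Y) X Z x =
      f x * koszul g Y X Z x + 2 * (dirDeriv I X f x * g.inner x (Y x) (Z x)) := by
  have h1 := dirDeriv_mul (X := X) hf (mdifferentiableAt_inner g hY hZ)
  have h2 := dirDeriv_mul (X := Z) hf (mdifferentiableAt_inner g hX hY)
  simp only [koszul, dirDeriv_smul_left, Pi.smul_apply', map_smul, smul_eq_mul, smul_apply, h1, h2,
    mlieBracket_smul_left hf hY, mlieBracket_smul_right hf hY, map_add, add_apply]
  simp only [dirDeriv]
  rw [g.symm x (Y x) (X x)]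
  ring

lemma tensorialAt_koszul_left (hY : MDiffAt (T% Y) x) (hZ : MDiffAt (T% Z) x) :
    TensorialAt I E (koszul g Y · Z x) x where
  smul hf hX := koszul_smul_left hf hX hY hZ
  add hX hX' := koszul_add_left hX hX' hY hZ

lemma tensorialAt_koszul_right (hY : MDiffAt (T% Y) x) (hX : MDiffAt (T% X) x) :
    TensorialAt I E (koszul g Y X · x) x where
  smul hf hZ := koszul_smul_right hf hX hY hZ
  add hZ hZ' := koszul_add_right hX hY hZ hZ'

variable (g)

instance (x : M) : FiniteDimensional ℝ (TangentSpace I x) :=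
  inferInstanceAs (FiniteDimensional ℝ E)

instance (x : M) : T2Space (TangentSpace I x) :=
  inferInstanceAs (T2Space E)

/-- The isomorphism between covectors and vectors induced by a Riemannian metric. -/
def sharp (x : M) : (TangentSpace I x →L[ℝ] ℝ) ≃ₗ[ℝ] TangentSpace I x :=
  (LinearMap.linearEquivOfInjective (K := ℝ)
    (V := TangentSpace I x) (V₂ := TangentSpace I x →L[ℝ] ℝ) (g.inner x).toLinearMap
    (by
      rw [← LinearMap.ker_eq_bot, LinearMap.ker_eq_bot']
      intro v hv
      by_contra hne
      have h := g.pos x v hne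
      rw [show g.inner x v = 0 from hv] at h
      simp at h)
    (by
      rw [← (LinearMap.toContinuousLinearMap (E := TangentSpace I x) (F' := ℝ)).finrank_eq]
      exact (Subspace.dual_finrank_eq (K := ℝ) (V := TangentSpace I x)).symm)).symm

lemma inner_sharp (x : M) (α : TangentSpace I x →L[ℝ] ℝ) (v : TangentSpace I x) :
    g.inner x (sharp g x α) v = α v := by
  have : (sharp g x).symm (sharp g x α) = α := LinearEquiv.symm_apply_apply _ _
  exact congrArg (fun β : TangentSpace I x →L[ℝ] ℝ ↦ β v) this

open scoped Classical in
/-- The Levi-Civita connection, as a bare function; it is zero at the points where the vector field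
is not differentiable. -/
def leviCivitaFun (Y : Π x : M, TangentSpace I x) (x : M) :
    TangentSpace I x →L[ℝ] TangentSpace I x :=
  if hY : MDiffAt (T% Y) x then
    (1 / 2 : ℝ) • LinearMap.toContinuousLinearMap ((sharp g x).toLinearMap ∘ₗ
      (TensorialAt.mkHom₂ (fun X Z ↦ koszul g Y X Z x) x
        (fun _ hZ ↦ tensorialAt_koszul_left hY hZ)
        (fun _ hX ↦ tensorialAt_koszul_right hY hX)).toLinearMap)
  else 0

lemma inner_leviCivitaFun (hX : MDiffAt (T% X) x) (hY : MDiffAt (T% Y) x)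
    (hZ : MDiffAt (T% Z) x) :
    g.inner x (leviCivitaFun g Y x (X x)) (Z x) = 1 / 2 * koszul g Y X Z x := by
  rw [leviCivitaFun, dif_pos hY]
  simp only [smul_apply, map_smul, smul_eq_mul]
  congr 1
  refine (inner_sharp g x _ _).trans ?_
  exact TensorialAt.mkHom₂_apply (fun _ hZ ↦ tensorialAt_koszul_left hY hZ)
    (fun _ hX ↦ tensorialAt_koszul_right hY hX) hX hZ

lemma inner_leviCivitaFun_eq_extend (hY : MDiffAt (T% Y) x) (u w : TangentSpace I x) :
    g.inner x (leviCivitaFun g Y x u) w =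
      1 / 2 * koszul g Y (FiberBundle.extend E u) (FiberBundle.extend E w) x := by
  simpa using inner_leviCivitaFun g (FiberBundle.mdifferentiableAt_extend I E u) hY
    (FiberBundle.mdifferentiableAt_extend I E w)

/-- The Levi-Civita connection of a Riemannian metric. -/
def leviCivita : CovariantDerivative I E (TangentSpace I : M → Type _) where
  toFun := leviCivitaFun g
  isCovariantDerivativeOnUniv :=
    { add := by
        intro Y Y' x hY hY' _
        ext u
        refine eq_of_inner_eq g fun w ↦ ?_
        rw [add_apply, map_add, add_apply, inner_leviCivitaFun_eq_extend g hY,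
          inner_leviCivitaFun_eq_extend g hY', inner_leviCivitaFun_eq_extend g
          (mdifferentiableAt_add_section hY hY'),
          koszul_add (FiberBundle.mdifferentiableAt_extend I E u) hY hY'
            (FiberBundle.mdifferentiableAt_extend I E w)]
        ring
      leibniz := by
        intro Y f x hY hf _
        ext u
        refine eq_of_inner_eq g fun w ↦ ?_
        rw [add_apply, map_add, add_apply, smul_apply, map_smul, smul_apply,
          inner_leviCivitaFun_eq_extend g hY,
          inner_leviCivitaFun_eq_extend g (hf.smul_section hY),
          koszul_smul hf (FiberBundle.mdifferentiableAt_extend I E u) hY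
            (FiberBundle.mdifferentiableAt_extend I E w)]
        simp [dirDeriv]
        ring }

lemma inner_leviCivita (hX : MDiffAt (T% X) x) (hY : MDiffAt (T% Y) x) (hZ : MDiffAt (T% Z) x) :
    g.inner x (leviCivita g Y x (X x)) (Z x) = 1 / 2 * koszul g Y X Z x :=
  inner_leviCivitaFun g hX hY hZ

lemma leviCivita_metric (hX : MDiffAt (T% X) x) (hY : MDiffAt (T% Y) x) (hZ : MDiffAt (T% Z) x) :
    dirDeriv I X (fun y ↦ g.inner y (Y y) (Z y)) x =
      g.inner x (leviCivita g Y x (X x)) (Z x) + g.inner x (Y x) (leviCivita g Z x (X x)) := by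
  rw [g.symm x (Y x), inner_leviCivita g hX hY hZ, inner_leviCivita g hX hZ hY]
  linear_combination -(1 / 2 : ℝ) * koszul_add_koszul_swap (g := g) (X := X) (Y := Y) (Z := Z)

lemma leviCivita_torsion : (leviCivita g).torsion = 0 := by
  rw [CovariantDerivative.torsion_eq_zero_iff]
  intro X Y x hX hY
  refine eq_of_inner_eq g fun w ↦ ?_
  have hw := FiberBundle.mdifferentiableAt_extend I E w
  have h1 := inner_leviCivita g hX hY hw
  have h2 := inner_leviCivita g hY hX hw
  have h3 := koszul_sub_koszul_swap (g := g) (X := X) (Y := Y) (Z := FiberBundle.extend E w) (x := x)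
  simp only [FiberBundle.extend_apply_self] at h1 h2 h3
  rw [map_sub, sub_apply, h1, h2]
  linear_combination (1 / 2 : ℝ) * h3

lemma contMDiff_koszul (hX : IsSmoothField I X) (hY : IsSmoothField I Y) (hZ : IsSmoothField I Z) :
    ContMDiff I 𝓘(ℝ) ∞ (koszul g Y X Z) :=
  (((((contMDiff_dirDeriv hX (contMDiff_inner g hY hZ)).add
    (contMDiff_dirDeriv hY (contMDiff_inner g hZ hX))).sub
    (contMDiff_dirDeriv hZ (contMDiff_inner g hX hY))).add
    (contMDiff_inner g (hX.mlieBracket hY) hZ)).sub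
    (contMDiff_inner g (hY.mlieBracket hZ) hX)).add
    (contMDiff_inner g (hZ.mlieBracket hX) hY)

lemma contMDiff_leviCivita [T2Space M] :
    CovariantDerivative.ContMDiffCovariantDerivative (leviCivita g) ∞ where
  contMDiff := by
    constructor
    intro Y hY
    have hY' : IsSmoothField I Y := contMDiffOn_univ.1 (by simpa using hY)
    rw [contMDiffOn_univ]
    refine isSmoothEnd_of_apply fun X hX ↦ isSmoothField_of_inner g fun Z hZ ↦ ?_
    refine ((contMDiff_const (c := (1 / 2 : ℝ))).mul (contMDiff_koszul g hX hY' hZ)).congr ?_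
    exact fun x ↦ inner_leviCivita g (hX.mdifferentiableAt x) (hY'.mdifferentiableAt x)
      (hZ.mdifferentiableAt x)

end LeviCivita

section CovariantDerivatives

variable {E : Type*} [NormedAddCommGroup E] [NormedSpace ℝ E]
  {H : Type*} [TopologicalSpace H] {I : ModelWithCorners ℝ E H}
  {M : Type*} [TopologicalSpace M] [ChartedSpace H M] [IsManifold I ∞ M]
  {g : ContMDiffRiemannianMetric I ∞ E (fun x : M ↦ TangentSpace I x)}
  {cov : CovariantDerivative I E (TangentSpace I : M → Type _)}
  {φ : Π x : M, TangentSpace I x →L[ℝ] TangentSpace I x}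
  {X Y Z ξ : Π x : M, TangentSpace I x} {x : M}

lemma tensorialAt_covDerivEnd (cov : CovariantDerivative I E (TangentSpace I : M → Type _))
    (hφ : IsSmoothEnd φ) (x : M) :
    TensorialAt I E (fun Y ↦ cov (applyEnd I φ Y) x - φ x ∘L cov Y x) x := by
  have hd : ∀ {Y : Π x : M, TangentSpace I x}, MDiffAt (T% Y) x →
      MDiffAt (T% (applyEnd I φ Y)) x := fun hY ↦
    MDifferentiableAt.clm_bundle_apply (F₁ := E) (F₂ := E) (b := fun x ↦ x)
      ((hφ x).mdifferentiableAt (by simp)) hY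
  constructor
  · intro f Y hf hY
    have h : applyEnd I φ (f • Y) = f • applyEnd I φ Y := by ext y; simp [applyEnd]
    rw [h, cov.isCovariantDerivativeOnUniv.leibniz hY hf,
      cov.isCovariantDerivativeOnUniv.leibniz (hd hY) hf]
    ext v
    simp [applyEnd]
    module
  · intro Y Y' hY hY'
    have h : applyEnd I φ (Y + Y') = applyEnd I φ Y + applyEnd I φ Y' := by
      ext y; simp [applyEnd]
    rw [h, cov.isCovariantDerivativeOnUniv.add hY hY',
      cov.isCovariantDerivativeOnUniv.add (hd hY) (hd hY')]
    ext v
    simp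
    module

variable [FiniteDimensional ℝ E]

lemma mlieBracket_eq_cov (hX : IsSmoothField I X) (hY : IsSmoothField I Y) (x : M) :
    mlieBracket I X Y x = cov Y x (X x) - cov X x (Y x) - cov.torsion x (X x) (Y x) := by
  rw [cov.torsion_apply (hX.mdifferentiableAt x) (hY.mdifferentiableAt x)]
  abel

/-- The covariant derivative of a field of endomorphisms as a tensor,
`endDeriv cov hφ x w v = (∇_v φ) w`. -/
def endDeriv (cov : CovariantDerivative I E (TangentSpace I : M → Type _))
    (hφ : IsSmoothEnd φ) (x : M) :
    TangentSpace I x →L[ℝ] TangentSpace I x →L[ℝ] TangentSpace I x :=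
  TensorialAt.mkHom _ x (tensorialAt_covDerivEnd cov hφ x)

lemma endDeriv_apply (hφ : IsSmoothEnd φ) (hY : IsSmoothField I Y) (x : M)
    (v : TangentSpace I x) : endDeriv cov hφ x (Y x) v = covDerivEnd I cov φ Y x v := by
  rw [endDeriv, TensorialAt.mkHom_apply (tensorialAt_covDerivEnd cov hφ x)
    (hY.mdifferentiableAt x)]
  rfl

lemma cov_applyEnd (hφ : IsSmoothEnd φ) (hY : IsSmoothField I Y) (x : M) (v : TangentSpace I x) :
    cov (applyEnd I φ Y) x v = endDeriv cov hφ x (Y x) v + φ x (cov Y x v) := by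
  rw [endDeriv_apply hφ hY, covDerivEnd]
  abel

lemma lieDerivEnd_eq (hφ : IsSmoothEnd φ) (hξ : IsSmoothField I ξ)
    (hX : IsSmoothField I X) (x : M) :
    lieDerivEnd I ξ φ X x = endDeriv cov hφ x (X x) (ξ x) - cov ξ x (φ x (X x))
      - cov.torsion x (ξ x) (φ x (X x)) + φ x (cov ξ x (X x))
      + φ x (cov.torsion x (ξ x) (X x)) := by
  simp only [lieDerivEnd, mlieBracket_eq_cov (cov := cov) hξ hX,
    mlieBracket_eq_cov (cov := cov) hξ (hφ.applyEnd hX), cov_applyEnd hφ hX, map_sub]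
  simp only [applyEnd]
  abel

lemma nijenhuis_eq (hφ : IsSmoothEnd φ) (η : Π x : M, TangentSpace I x →L[ℝ] ℝ)
    (hX : IsSmoothField I X) (hY : IsSmoothField I Y) (x : M) :
    nijenhuis I φ ξ η X Y x = endDeriv cov hφ x (Y x) (φ x (X x))
      - endDeriv cov hφ x (X x) (φ x (Y x)) - φ x (endDeriv cov hφ x (Y x) (X x))
      + φ x (endDeriv cov hφ x (X x) (Y x)) - cov.torsion x (φ x (X x)) (φ x (Y x))
      - φ x (φ x (cov.torsion x (X x) (Y x))) + φ x (cov.torsion x (φ x (X x)) (Y x))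
      + φ x (cov.torsion x (X x) (φ x (Y x))) + extDerivOne I η X Y x • ξ x := by
  simp only [nijenhuis, mlieBracket_eq_cov (cov := cov) hX hY,
    mlieBracket_eq_cov (cov := cov) (hφ.applyEnd hX) (hφ.applyEnd hY),
    mlieBracket_eq_cov (cov := cov) hX (hφ.applyEnd hY),
    mlieBracket_eq_cov (cov := cov) (hφ.applyEnd hX) hY, cov_applyEnd hφ hX, cov_applyEnd hφ hY,
    map_sub, map_add]
  simp only [applyEnd]
  abel

namespace IsMetricSkewTorsion

lemma smooth_apply (h : IsMetricSkewTorsion I g cov) (hX : IsSmoothField I X)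
    (hY : IsSmoothField I Y) : IsSmoothField I (fun x ↦ cov Y x (X x)) := by
  have h1 := h.smooth.contMDiff.contMDiff (σ := Y) (contMDiffOn_univ.2 (by simpa using! hY))
  exact IsSmoothEnd.apply (φ := cov Y) (contMDiffOn_univ.1 h1) hX

lemma extDerivOne_eq (h : IsMetricSkewTorsion I g cov) (hξ : IsSmoothField I ξ)
    {η : Π x : M, TangentSpace I x →L[ℝ] ℝ} (hη : ∀ x v, η x v = g.inner x v (ξ x))
    (hX : IsSmoothField I X) (hY : IsSmoothField I Y) (x : M) :
    extDerivOne I η X Y x = g.inner x (cov ξ x (X x)) (Y x) - g.inner x (cov ξ x (Y x)) (X x)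
      + torsion₃ I g cov x (X x) (Y x) (ξ x) := by
  simp only [extDerivOne, hη, mlieBracket_eq_cov (cov := cov) hX hY, torsion₃]
  rw [h.metric X Y ξ hX hY hξ, h.metric Y X ξ hY hX hξ, g.symm x (cov ξ x (X x)),
    g.symm x (cov ξ x (Y x))]
  simp only [map_sub, sub_apply]
  ring

lemma lieDerivMetric_eq (h : IsMetricSkewTorsion I g cov) (hξ : IsSmoothField I ξ)
    (hX : IsSmoothField I X) (hY : IsSmoothField I Y) (x : M) :
    lieDerivMetric I g ξ X Y x =
      g.inner x (cov ξ x (X x)) (Y x) + g.inner x (cov ξ x (Y x)) (X x) := by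
  have h1 := h.skew₂₃ x (ξ x) (X x) (Y x)
  simp only [torsion₃] at h1
  simp only [lieDerivMetric, mlieBracket_eq_cov (cov := cov) hξ hX,
    mlieBracket_eq_cov (cov := cov) hξ hY]
  rw [h.metric ξ X Y hξ hX hY]
  simp only [map_sub, sub_apply]
  linear_combination h1 + g.symm x (X x) (cov ξ x (Y x))
    + g.symm x (X x) (cov.torsion x (ξ x) (Y x))

lemma extDerivTwo_eq (h : IsMetricSkewTorsion I g cov) (hφ : IsSmoothEnd φ)
    (hsk : ∀ x u v, g.inner x (φ x u) v = -g.inner x u (φ x v))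
    (hX : IsSmoothField I X) (hY : IsSmoothField I Y) (hZ : IsSmoothField I Z) (x : M) :
    extDerivTwo I (fundForm I g φ) X Y Z x =
      g.inner x (Y x) (endDeriv cov hφ x (Z x) (X x))
      + g.inner x (Z x) (endDeriv cov hφ x (X x) (Y x))
      + g.inner x (X x) (endDeriv cov hφ x (Y x) (Z x))
      + torsion₃ I g cov x (X x) (Y x) (φ x (Z x)) + torsion₃ I g cov x (Y x) (Z x) (φ x (X x))
      + torsion₃ I g cov x (Z x) (X x) (φ x (Y x)) := by
  have hd : ∀ {U V W : Π x : M, TangentSpace I x}, IsSmoothField I U → IsSmoothField I V →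
      IsSmoothField I W → dirDeriv I U (fun y ↦ fundForm I g φ y (V y) (W y)) x =
        g.inner x (cov V x (U x)) (φ x (W x)) + g.inner x (V x) (endDeriv cov hφ x (W x) (U x))
          - g.inner x (cov W x (U x)) (φ x (V x)) := by
    intro U V W hU hV hW
    have := h.metric U V (applyEnd I φ W) hU hV (hφ.applyEnd hW) x
    rw [cov_applyEnd hφ hW, map_add] at this
    refine this.trans ?_
    have h2 := hsk x (V x) (cov W x (U x))
    rw [g.symm] at h2
    simp only [applyEnd]
    linear_combination h2
  simp only [extDerivTwo]
  rw [hd hX hY hZ, hd hY hZ hX, hd hZ hX hY]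
  simp only [fundForm, mlieBracket_eq_cov (cov := cov) hX hY, mlieBracket_eq_cov (cov := cov) hY hZ,
    mlieBracket_eq_cov (cov := cov) hZ hX, map_sub, sub_apply, torsion₃]
  ring

lemma torsion₃_eq_zero (hcov : IsMetricSkewTorsion I g cov) (x : M)
    (u v : TangentSpace I x) : torsion₃ I g cov x u v u = 0 ∧ torsion₃ I g cov x u v v = 0 := by
  have h1 := hcov.skew₂₃ x u v v
  have h2 := hcov.skew₂₃ x u v u
  have h3 := hcov.skew₁₂ x u u v
  constructor <;> linarith

end IsMetricSkewTorsion

end CovariantDerivatives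

namespace AlmostThreeContactMetric

section Algebra

variable {E : Type*} [NormedAddCommGroup E] [NormedSpace ℝ E]
  {H : Type*} [TopologicalSpace H] {I : ModelWithCorners ℝ E H}
  {M : Type*} [TopologicalSpace M] [ChartedSpace H M] [IsManifold I ∞ M]
  (S : AlmostThreeContactMetric I M)

lemma isSmoothEnd_φ (i : Fin 3) : IsSmoothEnd (S.φ i) := S.smooth_φ i

lemma isSmoothForm_η (i : Fin 3) : IsSmoothForm (S.η i) := S.smooth_η i

lemma η_φ_self (i : Fin 3) (x : M) (v : TangentSpace I x) : S.η i x (S.φ i x v) = 0 := by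
  have h1 := S.φ_sq i x (S.φ i x v)
  have h2 := congrArg (S.φ i x) (S.φ_sq i x v)
  have h3 := congrArg (S.η i x) (S.φ_sq i x (S.ξ i x))
  have h4 := S.φ_sq i x (S.ξ i x)
  rw [S.η_ξ, one_smul, neg_add_cancel] at h4
  -- `φ ξ` is a multiple of `ξ` annihilated by `φ`
  have h5 := S.φ_sq i x (S.φ i x (S.ξ i x))
  rw [h4, map_zero] at h5
  have h6 : S.φ i x (S.ξ i x) = S.η i x (S.φ i x (S.ξ i x)) • S.ξ i x := by
    rw [eq_comm, ← sub_eq_zero, h5]; abel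
  have h7 : S.η i x (S.φ i x (S.ξ i x)) = 0 := by
    have h := congrArg (S.φ i x) h6
    rw [h4, map_smul] at h
    nth_rewrite 2 [h6] at h
    rw [smul_smul] at h
    have := congrArg (S.η i x) h
    rw [map_zero, map_smul, S.η_ξ, smul_eq_mul, mul_one] at this
    exact mul_self_eq_zero.1 this.symm
  rw [h7, zero_smul] at h6
  rw [map_add, map_neg, map_smul, h6, smul_zero, add_zero, h1] at h2
  have h8 : S.η i x (S.φ i x v) • S.ξ i x = 0 := by simpa using h2
  have := congrArg (S.η i x) h8
  simpa [S.η_ξ] using this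

lemma φ_ξ_self (i : Fin 3) (x : M) : S.φ i x (S.ξ i x) = 0 := by
  have h4 := S.φ_sq i x (S.ξ i x)
  rw [S.η_ξ, one_smul, neg_add_cancel] at h4
  have h5 := S.φ_sq i x (S.φ i x (S.ξ i x))
  rw [h4, map_zero, S.η_φ_self, zero_smul, add_zero] at h5
  exact neg_eq_zero.1 h5.symm

lemma η_eq_inner (i : Fin 3) (x : M) (v : TangentSpace I x) :
    S.η i x v = S.g.inner x v (S.ξ i x) := by
  have h := S.compatible i x v (S.ξ i x)
  rw [S.φ_ξ_self, map_zero, S.η_ξ, mul_one] at h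
  linarith

lemma φ_skew (i : Fin 3) (x : M) (u v : TangentSpace I x) :
    S.g.inner x (S.φ i x u) v = -S.g.inner x u (S.φ i x v) := by
  have h := S.compatible i x u (S.φ i x v)
  rw [S.η_φ_self, mul_zero, sub_zero, S.φ_sq, map_add, map_neg, map_smul, ← S.η_eq_inner,
    S.η_φ_self, smul_zero, add_zero] at h
  linarith

/-- `φ_i ξ_{i+1} = ξ_{i+2}` -/
lemma φ_ξ_succ (i : Fin 3) (x : M) : S.φ i x (S.ξ (i + 1) x) = S.ξ (i + 2) x := (S.ξ_eq₁ i x).symm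

/-- `φ_i ξ_{i+2} = -ξ_{i+1}` -/
lemma φ_ξ_pred (i : Fin 3) (x : M) : S.φ i x (S.ξ (i + 2) x) = -S.ξ (i + 1) x := by
  have h := S.ξ_eq₂ (i + 2) x
  rw [show i + 2 + 2 = i + 1 by omega, show i + 2 + 1 = i by omega] at h
  rw [h, neg_neg]

/-- `η_i ∘ φ_{i+1} = η_{i+2}` -/
lemma η_φ_succ (i : Fin 3) (x : M) (v : TangentSpace I x) :
    S.η i x (S.φ (i + 1) x v) = S.η (i + 2) x v := (S.η_eq₁ i x v).symm

/-- `η_i ∘ φ_{i+2} = -η_{i+1}` -/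
lemma η_φ_pred (i : Fin 3) (x : M) (v : TangentSpace I x) :
    S.η i x (S.φ (i + 2) x v) = -S.η (i + 1) x v := by
  have h := S.η_eq₂ (i + 2) x v
  rw [show i + 2 + 2 = i + 1 by omega, show i + 2 + 1 = i by omega] at h
  rw [h, neg_neg]

lemma η_ξ_succ (i : Fin 3) (x : M) : S.η i x (S.ξ (i + 1) x) = 0 := by
  have h := S.η_φ_pred (i + 2) x (S.ξ (i + 1) x)
  rw [show i + 2 + 2 = i + 1 by omega, show i + 2 + 1 = i by omega, S.φ_ξ_self, map_zero] at h
  linarith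

lemma η_ξ_pred (i : Fin 3) (x : M) : S.η i x (S.ξ (i + 2) x) = 0 := by
  have h := S.η_φ_succ (i + 1) x (S.ξ (i + 2) x)
  rw [show i + 1 + 2 = i by omega, show i + 1 + 1 = i + 2 by omega, S.φ_ξ_self, map_zero] at h
  exact h.symm

lemma η_ξ_eq (i j : Fin 3) (x : M) : S.η i x (S.ξ j x) = if i = j then 1 else 0 := by
  obtain rfl | rfl | rfl : j = i ∨ j = i + 1 ∨ j = i + 2 := by omega
  · simp [S.η_ξ]
  · rw [S.η_ξ_succ, if_neg (by omega)]
  · rw [S.η_ξ_pred, if_neg (by omega)]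

/-- A tangent vector in `𝓗`. -/
def HorizontalAt (x : M) (v : TangentSpace I x) : Prop := ∀ i, S.η i x v = 0

variable {S} in
lemma HorizontalAt.φ {x : M} {v : TangentSpace I x} (hv : S.HorizontalAt x v) (i : Fin 3) :
    S.HorizontalAt x (S.φ i x v) := by
  intro j
  obtain rfl | rfl | rfl : i = j ∨ i = j + 1 ∨ i = j + 2 := by omega
  · exact S.η_φ_self i x v
  · rw [S.η_φ_succ, hv]
  · rw [S.η_φ_pred, hv, neg_zero]

variable {S} in
lemma HorizontalAt.φ_φ {x : M} {v : TangentSpace I x} (hv : S.HorizontalAt x v) (i : Fin 3) :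
    S.φ i x (S.φ i x v) = -v := by
  rw [S.φ_sq, hv, zero_smul, add_zero]

/-- `φ_i φ_{i+1} = φ_{i+2}` on `𝓗` -/
lemma HorizontalAt.φ_φ_succ {S : AlmostThreeContactMetric I M} {x : M} {v : TangentSpace I x}
    (hv : S.HorizontalAt x v) (i : Fin 3) :
    S.φ i x (S.φ (i + 1) x v) = S.φ (i + 2) x v := by
  rw [S.φ_eq₁, hv, zero_smul, sub_zero]

/-- `φ_{i+1} φ_i = -φ_{i+2}` on `𝓗` -/
lemma HorizontalAt.φ_succ_φ {S : AlmostThreeContactMetric I M} {x : M} {v : TangentSpace I x}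
    (hv : S.HorizontalAt x v) (i : Fin 3) :
    S.φ (i + 1) x (S.φ i x v) = -S.φ (i + 2) x v := by
  rw [S.φ_eq₂, hv, zero_smul, add_zero, neg_neg]

/-- The orthogonal projection onto `𝓗`. -/
def hor (x : M) : TangentSpace I x →L[ℝ] TangentSpace I x :=
  ContinuousLinearMap.id ℝ _ - ∑ i, (S.η i x).smulRight (S.ξ i x)

lemma hor_apply (x : M) (v : TangentSpace I x) :
    S.hor x v = v - ∑ i, S.η i x v • S.ξ i x := by
  simp [hor]

lemma horizontalAt_hor (x : M) (v : TangentSpace I x) : S.HorizontalAt x (S.hor x v) := by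
  intro i
  simp [hor_apply, η_ξ_eq]

variable {S} in
lemma HorizontalAt.hor_eq {x : M} {v : TangentSpace I x} (hv : S.HorizontalAt x v) :
    S.hor x v = v := by
  simp [hor_apply, hv _]

lemma hor_ξ (i : Fin 3) (x : M) : S.hor x (S.ξ i x) = 0 := by
  simp [hor_apply, η_ξ_eq]

lemma isSmoothField_hor {X : Π x : M, TangentSpace I x} (hX : IsSmoothField I X) :
    IsSmoothField I (fun x ↦ S.hor x (X x)) := by
  simp only [hor_apply]
  exact hX.sub (IsSmoothField.sum fun i _ ↦ .smul ((S.isSmoothForm_η i).apply hX) (S.smooth_ξ i))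

lemma isHorizontal_hor {X : Π x : M, TangentSpace I x} (hX : IsSmoothField I X) :
    S.IsHorizontal (fun x ↦ S.hor x (X x)) :=
  ⟨S.isSmoothField_hor hX, fun i x ↦ S.horizontalAt_hor x _ i⟩

variable {S} in
lemma IsHorizontal.horizontalAt {X : Π x : M, TangentSpace I x} (hX : S.IsHorizontal X) (x : M) :
    S.HorizontalAt x (X x) := fun i ↦ hX.2 i x

variable {S} in
lemma IsHorizontal.applyEnd {X : Π x : M, TangentSpace I x} (hX : S.IsHorizontal X) (i : Fin 3) :
    S.IsHorizontal (applyEnd I (S.φ i) X) :=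
  ⟨(S.isSmoothEnd_φ i).applyEnd hX.1, fun j x ↦ (hX.horizontalAt x).φ i j⟩

lemma inner_ξ_eq_zero {S : AlmostThreeContactMetric I M} {x : M} {v : TangentSpace I x}
    (hv : S.HorizontalAt x v) (i : Fin 3) : S.g.inner x (S.ξ i x) v = 0 := by
  rw [S.g.symm, ← S.η_eq_inner, hv]

lemma inner_ξ_ξ (i j : Fin 3) (x : M) :
    S.g.inner x (S.ξ i x) (S.ξ j x) = if i = j then 1 else 0 := by
  rw [← S.η_eq_inner, η_ξ_eq]
  simp [eq_comm]

lemma φSphere_apply (a : Fin 3 → ℝ) (x : M) (v : TangentSpace I x) :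
    S.φSphere a x v = ∑ i, a i • S.φ i x v := by
  simp [φSphere]

lemma isSmoothEnd_φSphere [FiniteDimensional ℝ E] [T2Space M] (a : Fin 3 → ℝ) :
    IsSmoothEnd (S.φSphere a) :=
  isSmoothEnd_of_apply fun X hX ↦ by
    simp only [φSphere_apply]
    exact IsSmoothField.sum fun i _ ↦ ((S.isSmoothEnd_φ i).apply hX).const_smul (a i)

lemma φSphere_skew (a : Fin 3 → ℝ) (x : M) (u v : TangentSpace I x) :
    S.g.inner x (S.φSphere a x u) v = -S.g.inner x u (S.φSphere a x v) := by
  simp [φSphere_apply, φ_skew]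

variable {S} in
lemma HorizontalAt.φSphere {x : M} {v : TangentSpace I x} (hv : S.HorizontalAt x v)
    (a : Fin 3 → ℝ) : S.HorizontalAt x (S.φSphere a x v) := by
  intro j
  simp [φSphere_apply, fun i ↦ hv.φ i j]

lemma HorizontalAt.φSphere_φSphere {S : AlmostThreeContactMetric I M} {x : M}
    {v : TangentSpace I x} (hv : S.HorizontalAt x v) {a : Fin 3 → ℝ} (ha : ∑ i, a i ^ 2 = 1) :
    S.φSphere a x (S.φSphere a x v) = -v := by
  have h01 : S.φ 0 x (S.φ 1 x v) = S.φ 2 x v := hv.φ_φ_succ 0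
  have h12 : S.φ 1 x (S.φ 2 x v) = S.φ 0 x v := hv.φ_φ_succ 1
  have h20 : S.φ 2 x (S.φ 0 x v) = S.φ 1 x v := hv.φ_φ_succ 2
  have h10 : S.φ 1 x (S.φ 0 x v) = -S.φ 2 x v := hv.φ_succ_φ 0
  have h21 : S.φ 2 x (S.φ 1 x v) = -S.φ 0 x v := hv.φ_succ_φ 1
  have h02 : S.φ 0 x (S.φ 2 x v) = -S.φ 1 x v := hv.φ_succ_φ 2
  rw [Fin.sum_univ_three] at ha
  have : -v = -((a 0 ^ 2 + a 1 ^ 2 + a 2 ^ 2) • v) := by rw [ha, one_smul]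
  rw [this]
  simp only [φSphere_apply, Fin.sum_univ_three, map_add, map_smul, hv.φ_φ, h01, h12, h20, h10, h21,
    h02]
  module

end Algebra

end AlmostThreeContactMetric

namespace AlmostThreeContactMetric

section CanonicalConnection

variable {E : Type*} [NormedAddCommGroup E] [NormedSpace ℝ E] [FiniteDimensional ℝ E]
  {H : Type*} [TopologicalSpace H] {I : ModelWithCorners ℝ E H}
  {M : Type*} [TopologicalSpace M] [ChartedSpace H M] [IsManifold I ∞ M]
  {S : AlmostThreeContactMetric I M}
  {cov : CovariantDerivative I E (TangentSpace I : M → Type _)}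
  {β : M → ℝ} {X Y Z : Π x : M, TangentSpace I x}

/-- If `(∇_X φ) Y = 0` for horizontal `X`, `Y`, then `N_φ` is determined on `𝓗` by the
torsion. -/
lemma inner_nijenhuis_of_parallel
    {φ : Π x : M, TangentSpace I x →L[ℝ] TangentSpace I x} (hφ : IsSmoothEnd φ)
    (hsk : ∀ x u v, S.g.inner x (φ x u) v = -S.g.inner x u (φ x v)) {x : M}
    (hhor : ∀ v, S.HorizontalAt x v → S.HorizontalAt x (φ x v))
    (hsq : ∀ v, S.HorizontalAt x v → φ x (φ x v) = -v)
    (hpar : ∀ u v, S.HorizontalAt x u → S.HorizontalAt x v → endDeriv cov hφ x u v = 0)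
    (η : Π x : M, TangentSpace I x →L[ℝ] ℝ) {ξ : Π x : M, TangentSpace I x}
    (hξ : ∀ v, S.HorizontalAt x v → S.g.inner x (ξ x) v = 0)
    (hX : S.IsHorizontal X) (hY : S.IsHorizontal Y) (hZ : S.IsHorizontal Z) :
    S.g.inner x (nijenhuis I φ ξ η X Y x) (Z x) =
      torsion₃ I S.g cov x (X x) (Y x) (Z x)
        - torsion₃ I S.g cov x (φ x (X x)) (φ x (Y x)) (Z x)
        - torsion₃ I S.g cov x (φ x (X x)) (Y x) (φ x (Z x))
        - torsion₃ I S.g cov x (X x) (φ x (Y x)) (φ x (Z x)) := by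
  have hX' := hX.horizontalAt x
  have hY' := hY.horizontalAt x
  have hZ' := hZ.horizontalAt x
  rw [nijenhuis_eq (cov := cov) hφ η hX.1 hY.1, hpar _ _ hY' (hhor _ hX'),
    hpar _ _ hX' (hhor _ hY'), hpar _ _ hY' hX', hpar _ _ hX' hY']
  simp only [map_zero, map_add, map_sub, map_smul, add_apply, sub_apply, smul_apply, hsk, hξ _ hZ',
    hsq _ hZ', map_neg, torsion₃, zero_apply, smul_zero]
  ring

lemma extDerivTwo_of_parallel (hcov : IsMetricSkewTorsion I S.g cov)
    {φ : Π x : M, TangentSpace I x →L[ℝ] TangentSpace I x} (hφ : IsSmoothEnd φ)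
    (hsk : ∀ x u v, S.g.inner x (φ x u) v = -S.g.inner x u (φ x v)) {x : M}
    (hhor : ∀ v, S.HorizontalAt x v → S.HorizontalAt x (φ x v))
    (hsq : ∀ v, S.HorizontalAt x v → φ x (φ x v) = -v)
    (hpar : ∀ u v, S.HorizontalAt x u → S.HorizontalAt x v → endDeriv cov hφ x u v = 0)
    (hX : S.IsHorizontal X) (hY : S.IsHorizontal Y) (hZ : S.IsHorizontal Z) :
    extDerivTwo I (fundForm I S.g φ) (applyEnd I φ X) (applyEnd I φ Y) (applyEnd I φ Z) x =
      - torsion₃ I S.g cov x (φ x (X x)) (φ x (Y x)) (Z x)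
        - torsion₃ I S.g cov x (φ x (X x)) (Y x) (φ x (Z x))
        - torsion₃ I S.g cov x (X x) (φ x (Y x)) (φ x (Z x)) := by
  have hX' := hX.horizontalAt x
  have hY' := hY.horizontalAt x
  have hZ' := hZ.horizontalAt x
  rw [hcov.extDerivTwo_eq hφ hsk (hφ.applyEnd hX.1) (hφ.applyEnd hY.1) (hφ.applyEnd hZ.1)]
  simp only [applyEnd]
  rw [hpar _ _ (hhor _ hZ') (hhor _ hX'), hpar _ _ (hhor _ hX') (hhor _ hY'),
    hpar _ _ (hhor _ hY') (hhor _ hZ'), hsq _ hX', hsq _ hY', hsq _ hZ']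
  have h1 := hcov.skew₁₂ x (φ x (Z x)) (φ x (X x)) (Y x)
  have h2 := hcov.skew₂₃ x (φ x (X x)) (φ x (Z x)) (Y x)
  have h3 := hcov.skew₂₃ x (φ x (Y x)) (φ x (Z x)) (X x)
  have h4 := hcov.skew₁₂ x (φ x (Y x)) (X x) (φ x (Z x))
  simp only [torsion₃] at h1 h2 h3 h4
  simp only [map_zero, map_neg, torsion₃]
  linarith

lemma torsion_eq_of_parallel (hcov : IsMetricSkewTorsion I S.g cov)
    {φ : Π x : M, TangentSpace I x →L[ℝ] TangentSpace I x} (hφ : IsSmoothEnd φ)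
    (hsk : ∀ x u v, S.g.inner x (φ x u) v = -S.g.inner x u (φ x v)) {x : M}
    (hhor : ∀ v, S.HorizontalAt x v → S.HorizontalAt x (φ x v))
    (hsq : ∀ v, S.HorizontalAt x v → φ x (φ x v) = -v)
    (hpar : ∀ u v, S.HorizontalAt x u → S.HorizontalAt x v → endDeriv cov hφ x u v = 0)
    (η : Π x : M, TangentSpace I x →L[ℝ] ℝ) {ξ : Π x : M, TangentSpace I x}
    (hξ : ∀ v, S.HorizontalAt x v → S.g.inner x (ξ x) v = 0)
    (hX : S.IsHorizontal X) (hY : S.IsHorizontal Y) (hZ : S.IsHorizontal Z) :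
    torsion₃ I S.g cov x (X x) (Y x) (Z x) =
      S.g.inner x (nijenhuis I φ ξ η X Y x) (Z x)
        - extDerivTwo I (fundForm I S.g φ) (applyEnd I φ X) (applyEnd I φ Y) (applyEnd I φ Z) x := by
  rw [inner_nijenhuis_of_parallel (cov := cov) hφ hsk hhor hsq hpar η hξ hX hY hZ,
    extDerivTwo_of_parallel hcov hφ hsk hhor hsq hpar hX hY hZ]
  ring

lemma inner_cov_ξ_add (hcov : IsMetricSkewTorsion I S.g cov) [T2Space M] (i j : Fin 3) (x : M)
    (v : TangentSpace I x) :
    S.g.inner x (cov (S.ξ i) x v) (S.ξ j x) + S.g.inner x (S.ξ i x) (cov (S.ξ j) x v) = 0 := by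
  obtain ⟨V, hV, rfl⟩ := exists_smoothField_eq x v
  rw [← hcov.metric V _ _ hV (S.smooth_ξ i) (S.smooth_ξ j)]
  simp [inner_ξ_ξ, dirDeriv, mvfderiv_const]

lemma torsion_ξ_eq_of_cov_ξ (hcov : IsMetricSkewTorsion I S.g cov)
    (hξ : ∀ i x v, S.HorizontalAt x v → cov (S.ξ i) x v = 0) (i : Fin 3)
    (hX : S.IsHorizontal X) (hY : S.IsHorizontal Y) (x : M) :
    torsion₃ I S.g cov x (X x) (Y x) (S.ξ i x) = extDerivOne I (S.η i) X Y x := by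
  rw [hcov.extDerivOne_eq (S.smooth_ξ i) (S.η_eq_inner i) hX.1 hY.1,
    hξ i x _ (hX.horizontalAt x), hξ i x _ (hY.horizontalAt x)]
  simp

lemma A_eq_of_cov_ξ (hcov : IsMetricSkewTorsion I S.g cov)
    (hξ : ∀ i x v, S.HorizontalAt x v → cov (S.ξ i) x v = 0) (i j : Fin 3)
    (hX : S.IsHorizontal X) (hY : S.IsHorizontal Y) (x : M) :
    S.A i j X Y x = S.g.inner x (endDeriv cov (S.isSmoothEnd_φ i) x (X x) (S.ξ j x)) (Y x) := by
  have e1 := torsion_ξ_eq_of_cov_ξ hcov hξ j hX (hY.applyEnd i) x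
  have e2 := torsion_ξ_eq_of_cov_ξ hcov hξ j (hX.applyEnd i) hY x
  have k1 := hcov.skew₂₃ x (X x) (S.ξ j x) (S.φ i x (Y x))
  have k2 := hcov.skew₁₂ x (X x) (S.ξ j x) (S.φ i x (Y x))
  have k3 := hcov.skew₂₃ x (S.φ i x (X x)) (S.ξ j x) (Y x)
  have k4 := hcov.skew₁₂ x (S.φ i x (X x)) (S.ξ j x) (Y x)
  simp only [applyEnd] at e1 e2
  rw [A, ← e1, ← e2, lieDerivEnd_eq (cov := cov) (S.isSmoothEnd_φ i) (S.smooth_ξ j) hX.1,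
    hξ j x _ (hX.horizontalAt x),
    hξ j x _ ((hX.horizontalAt x).φ i)]
  simp only [map_zero, map_add, map_sub, add_apply, sub_apply, S.φ_skew, zero_apply, torsion₃] at *
  linarith

namespace IsCanonicalConnection

variable [T2Space M]

lemma endDeriv_φ (h : S.IsCanonicalConnection cov β) (i : Fin 3) (x : M)
    (w v : TangentSpace I x) : endDeriv cov (S.isSmoothEnd_φ i) x w v =
      β x • (S.η (i + 2) x v • S.φ (i + 1) x w - S.η (i + 1) x v • S.φ (i + 2) x w) := by
  obtain ⟨V, hV, rfl⟩ := exists_smoothField_eq x v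
  obtain ⟨W, hW, rfl⟩ := exists_smoothField_eq x w
  rw [endDeriv_apply _ hW, h.deriv_φ i V W hV hW]

lemma cov_ξ (h : S.IsCanonicalConnection cov β) (i : Fin 3) (x : M) (v : TangentSpace I x) :
    cov (S.ξ i) x v =
      β x • (S.η (i + 2) x v • S.ξ (i + 1) x - S.η (i + 1) x v • S.ξ (i + 2) x) := by
  have h1 := cov_applyEnd (cov := cov) (S.isSmoothEnd_φ i) (S.smooth_ξ i) x v
  have h0 : applyEnd I (S.φ i) (S.ξ i) = 0 := by ext y; simp [applyEnd, S.φ_ξ_self]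
  rw [h0, CovariantDerivative.zero, h.endDeriv_φ] at h1
  have h2 := inner_cov_ξ_add h.metricSkew i i x v
  rw [S.g.symm x (S.ξ i x), ← S.η_eq_inner] at h2
  have h3 := S.φ_sq i x (cov (S.ξ i) x v)
  have e1 : S.φ (i + 1) x (S.ξ i x) = -S.ξ (i + 2) x := by
    have := S.φ_ξ_pred (i + 1) x
    rwa [show i + 1 + 2 = i by omega, show i + 1 + 1 = i + 2 by omega] at this
  have e2 : S.φ (i + 2) x (S.ξ i x) = S.ξ (i + 1) x := by
    have := S.φ_ξ_succ (i + 2) x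
    rwa [show i + 2 + 2 = i + 1 by omega, show i + 2 + 1 = i by omega] at this
  rw [show S.η i x (cov (S.ξ i) x v) = 0 by linarith, zero_smul, add_zero] at h3
  have h4 : S.φ i x (cov (S.ξ i) x v) =
      β x • (S.η (i + 2) x v • S.ξ (i + 2) x + S.η (i + 1) x v • S.ξ (i + 1) x) := by
    rw [e1, e2] at h1
    rw [eq_neg_of_add_eq_zero_right h1.symm]
    module
  rw [h4] at h3
  rw [← neg_neg (cov (S.ξ i) x v), ← h3]
  simp only [map_smul, map_add, S.φ_ξ_succ, S.φ_ξ_pred]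
  module

lemma cov_ξ_of_horizontalAt (h : S.IsCanonicalConnection cov β) (i : Fin 3) {x : M}
    {v : TangentSpace I x} (hv : S.HorizontalAt x v) : cov (S.ξ i) x v = 0 := by
  rw [h.cov_ξ, hv, hv, zero_smul, zero_smul, sub_zero, smul_zero]

lemma endDeriv_φSphere (h : S.IsCanonicalConnection cov β) (a : Fin 3 → ℝ) {x : M}
    {w v : TangentSpace I x} (hv : S.HorizontalAt x v) :
    endDeriv cov (S.isSmoothEnd_φSphere a) x w v = 0 := by
  obtain ⟨W, hW, rfl⟩ := exists_smoothField_eq x w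
  have hd := fun i ↦ ((S.isSmoothEnd_φ i).applyEnd hW).mdifferentiableAt x
  have hd' := fun i ↦ (((S.isSmoothEnd_φ i).applyEnd hW).const_smul (a i)).mdifferentiableAt x
  have h1 : applyEnd I (S.φSphere a) W = a 0 • applyEnd I (S.φ 0) W + a 1 • applyEnd I (S.φ 1) W
      + a 2 • applyEnd I (S.φ 2) W := by
    ext y
    simp [applyEnd, φSphere_apply, Fin.sum_univ_three]
  rw [endDeriv_apply _ hW, covDerivEnd, h1,
    cov.isCovariantDerivativeOnUniv.add (mdifferentiableAt_add_section (hd' 0) (hd' 1)) (hd' 2),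
    cov.isCovariantDerivativeOnUniv.add (hd' 0) (hd' 1),
    cov.isCovariantDerivativeOnUniv.smul_const _ (hd 0),
    cov.isCovariantDerivativeOnUniv.smul_const _ (hd 1),
    cov.isCovariantDerivativeOnUniv.smul_const _ (hd 2)]
  simp only [add_apply, smul_apply, cov_applyEnd (S.isSmoothEnd_φ _) hW, h.endDeriv_φ, hv _,
    φSphere_apply, Fin.sum_univ_three]
  module

lemma inner_nijenhuis (h : S.IsCanonicalConnection cov β) (i : Fin 3)
    (hX : S.IsHorizontal X) (hY : S.IsHorizontal Y) (hZ : S.IsHorizontal Z) (x : M) :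
    S.N i X Y Z x = torsion₃ I S.g cov x (X x) (Y x) (Z x)
        - torsion₃ I S.g cov x (S.φ i x (X x)) (S.φ i x (Y x)) (Z x)
        - torsion₃ I S.g cov x (S.φ i x (X x)) (Y x) (S.φ i x (Z x))
        - torsion₃ I S.g cov x (X x) (S.φ i x (Y x)) (S.φ i x (Z x)) :=
  inner_nijenhuis_of_parallel (S.isSmoothEnd_φ i) (S.φ_skew i)
    (fun _ hv ↦ hv.φ i) (fun _ hv ↦ hv.φ_φ i)
    (fun u v _ hv ↦ by rw [h.endDeriv_φ, hv, hv, zero_smul, zero_smul, sub_zero, smul_zero])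
    _ (fun _ hv ↦ inner_ξ_eq_zero hv i) hX hY hZ

lemma torsion_eq (h : S.IsCanonicalConnection cov β) (i : Fin 3)
    (hX : S.IsHorizontal X) (hY : S.IsHorizontal Y) (hZ : S.IsHorizontal Z) (x : M) :
    torsion₃ I S.g cov x (X x) (Y x) (Z x) =
      S.N i X Y Z x - extDerivTwo I (fundForm I S.g (S.φ i))
        (applyEnd I (S.φ i) X) (applyEnd I (S.φ i) Y) (applyEnd I (S.φ i) Z) x :=
  torsion_eq_of_parallel h.metricSkew (S.isSmoothEnd_φ i) (S.φ_skew i)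
    (fun _ hv ↦ hv.φ i) (fun _ hv ↦ hv.φ_φ i)
    (fun u v _ hv ↦ by rw [h.endDeriv_φ, hv, hv, zero_smul, zero_smul, sub_zero, smul_zero])
    _ (fun _ hv ↦ inner_ξ_eq_zero hv i) hX hY hZ

lemma torsion_ξ_eq (h : S.IsCanonicalConnection cov β) (i : Fin 3)
    (hX : S.IsHorizontal X) (hY : S.IsHorizontal Y) (x : M) :
    torsion₃ I S.g cov x (X x) (Y x) (S.ξ i x) = extDerivOne I (S.η i) X Y x :=
  torsion_ξ_eq_of_cov_ξ h.metricSkew (fun _ _ _ ↦ h.cov_ξ_of_horizontalAt _) i hX hY x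

lemma torsion_ξ_ξ_eq (h : S.IsCanonicalConnection cov β) (i j : Fin 3)
    (hX : S.IsHorizontal X) (x : M) :
    torsion₃ I S.g cov x (X x) (S.ξ i x) (S.ξ j x) =
      -S.g.inner x (mlieBracket I (S.ξ i) (S.ξ j) x) (X x) := by
  rw [h.metricSkew.skew₁₂, h.metricSkew.skew₂₃,
    mlieBracket_eq_cov (cov := cov) (S.smooth_ξ i) (S.smooth_ξ j), h.cov_ξ, h.cov_ξ]
  simp [torsion₃, inner_ξ_eq_zero (hX.horizontalAt x)]

lemma torsionFormulas (h : S.IsCanonicalConnection cov β) {a : Fin 3 → ℝ}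
    (ha : ∑ i, a i ^ 2 = 1) : S.TorsionFormulas a cov where
  horizontal X Y Z hX hY hZ x :=
    torsion_eq_of_parallel h.metricSkew (S.isSmoothEnd_φSphere a) (S.φSphere_skew a)
      (fun _ hv ↦ hv.φSphere a) (fun _ hv ↦ hv.φSphere_φSphere ha)
      (fun u v _ hv ↦ h.endDeriv_φSphere a hv) _
      (fun v hv ↦ by simp [ξSphere, inner_ξ_eq_zero hv]) hX hY hZ
  mixed₁ i _ _ hX hY x := h.torsion_ξ_eq i hX hY x
  mixed₂ i j _ hX x := h.torsion_ξ_ξ_eq i j hX x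

lemma isKilling (h : S.IsCanonicalConnection cov β) (i : Fin 3) : IsKilling I S.g (S.ξ i) := by
  intro X Y hX hY x
  rw [h.metricSkew.lieDerivMetric_eq (S.smooth_ξ i) hX hY, h.cov_ξ, h.cov_ξ]
  simp only [map_smul, map_sub, smul_apply, sub_apply, S.g.symm x (S.ξ _ x), ← S.η_eq_inner,
    smul_eq_mul]
  ring

lemma A_eq (h : S.IsCanonicalConnection cov β) (i j : Fin 3)
    (hX : S.IsHorizontal X) (hY : S.IsHorizontal Y) (x : M) :
    S.A i j X Y x = S.g.inner x (endDeriv cov (S.isSmoothEnd_φ i) x (X x) (S.ξ j x)) (Y x) :=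
  A_eq_of_cov_ξ h.metricSkew (fun _ _ _ ↦ h.cov_ξ_of_horizontalAt _) i j hX hY x

lemma isReebKillingFunction (h : S.IsCanonicalConnection cov β) : S.IsReebKillingFunction β where
  smooth := h.smooth
  diag i X Y hX hY x := by
    rw [h.A_eq i i hX hY, h.endDeriv_φ, S.η_ξ_eq, S.η_ξ_eq, if_neg (by omega), if_neg (by omega)]
    simp
  offDiag i X Y hX hY x := by
    rw [h.A_eq i _ hX hY, h.A_eq _ i hX hY, h.endDeriv_φ, h.endDeriv_φ]
    simp only [η_ξ_eq, show i + 1 + 1 = i + 2 by omega, show i + 1 + 2 = i by omega, if_true]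
    rw [if_neg (by omega), if_neg (by omega)]
    simp [fundForm, S.φ_skew]

lemma isCanonical (h : S.IsCanonicalConnection cov β) : S.IsCanonical where
  skew i X Y Z hX hY hZ x := by
    rw [h.inner_nijenhuis i hX hY hZ, h.inner_nijenhuis i hY hX hZ, h.inner_nijenhuis i hX hZ hY]
    have k1 := h.metricSkew.skew₁₂ x
    have k2 := h.metricSkew.skew₂₃ x
    constructor
    · rw [k1 (Y x) (X x), k1 (S.φ i x (Y x)), k1 (S.φ i x (Y x)) (X x),
        k1 (Y x) (S.φ i x (X x))]
      ring
    · rw [k2 (X x) (Z x), k2 (S.φ i x (X x)) (S.φ i x (Z x)), k2 (S.φ i x (X x)) (Z x),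
        k2 (X x) (S.φ i x (Z x))]
      ring
  killing := h.isKilling
  independent i j X Y Z hX hY hZ x := by
    rw [← h.torsion_eq i hX hY hZ, ← h.torsion_eq j hX hY hZ]
  reebKilling := ⟨β, h.isReebKillingFunction⟩

lemma η_mlieBracket_ξ (h : S.IsCanonicalConnection cov β) (i k : Fin 3) (x : M) :
    S.η k x (mlieBracket I (S.ξ i) (S.ξ (i + 1)) x) =
      2 * β x * (if k = i + 2 then 1 else 0)
        - torsion₃ I S.g cov x (S.ξ i x) (S.ξ (i + 1) x) (S.ξ k x) := by
  rw [mlieBracket_eq_cov (cov := cov) (S.smooth_ξ _) (S.smooth_ξ _), h.cov_ξ, h.cov_ξ,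
    show i + 1 + 1 = i + 2 by omega, show i + 1 + 2 = i by omega]
  simp only [η_ξ_eq, map_sub, map_smul, torsion₃, ← S.η_eq_inner, smul_eq_mul, if_true]
  rw [if_neg (show i + 2 ≠ i by omega), if_neg (show i + 2 ≠ i + 1 by omega)]
  ring

lemma torsion_ξ (h : S.IsCanonicalConnection cov β) {δ : M → ℝ}
    (hδ : S.IsReebCommutatorFunction δ) (x : M) :
    torsion₃ I S.g cov x (S.ξ 0 x) (S.ξ 1 x) (S.ξ 2 x) = 2 * (β x - δ x) := by
  have h1 := h.η_mlieBracket_ξ 0 2 x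
  have h2 := hδ.bracket 0 1 2 x
  simp [epsilon] at h1 h2
  linarith

lemma exists_isReebCommutatorFunction (h : S.IsCanonicalConnection cov β) :
    ∃ δ, S.IsReebCommutatorFunction δ := by
  refine ⟨fun x ↦ 1 / 2 * S.η 2 x (mlieBracket I (S.ξ 0) (S.ξ 1) x), ?_, ?_⟩
  · exact contMDiff_const.mul ((S.isSmoothForm_η 2).apply
      ((S.smooth_ξ 0).mlieBracket (S.smooth_ξ 1)))
  · have key : ∀ (i k : Fin 3) (x : M), S.η k x (mlieBracket I (S.ξ i) (S.ξ (i + 1)) x) =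
        2 * (1 / 2 * S.η 2 x (mlieBracket I (S.ξ 0) (S.ξ 1) x)) * epsilon i (i + 1) k := by
      intro i k x
      have h0 := h.η_mlieBracket_ξ 0 2 x
      simp only [zero_add, if_true] at h0
      rw [h.η_mlieBracket_ξ, h0]
      have hcyc : ∀ j : Fin 3, torsion₃ I S.g cov x (S.ξ j x) (S.ξ (j + 1) x) (S.ξ (j + 2) x) =
          torsion₃ I S.g cov x (S.ξ 0 x) (S.ξ 1 x) (S.ξ 2 x) := by
        have hr : ∀ u v w, torsion₃ I S.g cov x u v w = torsion₃ I S.g cov x v w u := fun u v w ↦ by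
          rw [h.metricSkew.skew₁₂, h.metricSkew.skew₂₃, neg_neg]
        intro j
        fin_cases j
        · rfl
        · exact (hr _ _ _).symm
        · exact hr _ _ _
      obtain rfl | rfl | rfl : k = i ∨ k = i + 1 ∨ k = i + 2 := by omega
      · simp [epsilon, (h.metricSkew.torsion₃_eq_zero x _ _).1]
      · simp [epsilon, (h.metricSkew.torsion₃_eq_zero x _ _).2]
      · rw [hcyc i]
        simp [epsilon]
    intro i j k x
    obtain rfl | rfl | rfl : j = i ∨ j = i + 1 ∨ i = j + 1 := by omega
    · simp [epsilon]
    · exact key i k x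
    · rw [mlieBracket_swap_apply, map_neg, key j k x]
      have : epsilon (j + 1) j k = -epsilon j (j + 1) k := by
        fin_cases j <;> fin_cases k <;> simp [epsilon]
      rw [this]
      ring

lemma isHorizontal_cov (h : S.IsCanonicalConnection cov β) (hX : IsSmoothField I X)
    (hY : S.IsHorizontal Y) : S.IsHorizontal (fun x ↦ cov Y x (X x)) := by
  refine ⟨h.metricSkew.smooth_apply hX hY.1, fun i x ↦ ?_⟩
  have h1 := h.metricSkew.metric X Y (S.ξ i) hX hY.1 (S.smooth_ξ i) x
  simp only [← S.η_eq_inner, hY.2] at h1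
  rw [h.cov_ξ] at h1
  simp only [map_smul, map_sub, ← S.η_eq_inner, hY.2] at h1
  simpa [dirDeriv, mvfderiv_const] using h1.symm

lemma isVertical_cov (h : S.IsCanonicalConnection cov β) (hX : IsSmoothField I X)
    (hY : S.IsVertical Y) : S.IsVertical (fun x ↦ cov Y x (X x)) := by
  refine ⟨h.metricSkew.smooth_apply hX hY.1, fun x ↦ ?_⟩
  have hortho : ∀ (y : M) (v : TangentSpace I y), S.HorizontalAt y v → S.g.inner y (Y y) v = 0 := by
    intro y v hv
    refine Submodule.span_induction (p := fun w _ ↦ S.g.inner y w v = 0) ?_ ?_ ?_ ?_ (hY.2 y)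
    · rintro _ ⟨i, rfl⟩
      exact inner_ξ_eq_zero hv i
    · simp
    · intro u w _ _ hu hw; simp [hu, hw]
    · intro a u _ hu; simp [hu]
  obtain ⟨W, hW, hWx⟩ := exists_smoothField_eq x (S.hor x (cov Y x (X x)))
  have hW' := S.isHorizontal_hor hW
  have h1 := h.metricSkew.metric X Y _ hX hY.1 hW'.1 x
  rw [hortho _ _ ((h.isHorizontal_cov hX hW').horizontalAt x)] at h1
  simp only [fun y ↦ hortho y _ (S.horizontalAt_hor y (W y))] at h1
  rw [hWx, (S.horizontalAt_hor x _).hor_eq] at h1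
  set c := cov Y x (X x)
  have h2 : S.g.inner x (S.hor x c) (S.hor x c) = 0 := by
    nth_rewrite 1 [hor_apply]
    rw [map_sub, sub_apply]
    simp only [map_sum, sum_apply, map_smul, smul_apply, inner_ξ_eq_zero (S.horizontalAt_hor x c)]
    simpa [dirDeriv, mvfderiv_const] using h1.symm
  have h3 : S.hor x c = 0 := by
    by_contra hne
    exact (S.g.pos x _ hne).ne' h2
  rw [hor_apply, sub_eq_zero] at h3
  change c ∈ _
  rw [h3]
  exact Submodule.sum_mem _ fun i _ ↦ Submodule.smul_mem _ _ (Submodule.subset_span ⟨i, rfl⟩)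

lemma isCompatibleConnection (h : S.IsCanonicalConnection cov β) (a : Fin 3 → ℝ) :
    S.IsCompatibleConnection a cov where
  metricSkew := h.metricSkew
  horizontal _ _ hX hY := h.isHorizontal_cov hX hY
  vertical _ _ hX hY := h.isVertical_cov hX hY
  parallel X Y hX hY x := by
    rw [← endDeriv_apply (S.isSmoothEnd_φSphere a) hY.1, h.endDeriv_φSphere a (hX.horizontalAt x)]

end IsCanonicalConnection

end CanonicalConnection

end AlmostThreeContactMetric

namespace AlmostThreeContactMetric

section Uniqueness

variable {E : Type*} [NormedAddCommGroup E] [NormedSpace ℝ E] [FiniteDimensional ℝ E]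
  {H : Type*} [TopologicalSpace H] {I : ModelWithCorners ℝ E H}
  {M : Type*} [TopologicalSpace M] [ChartedSpace H M] [IsManifold I ∞ M]
  {S : AlmostThreeContactMetric I M}
  {cov cov' : CovariantDerivative I E (TangentSpace I : M → Type _)} {β β' : M → ℝ}

lemma exists_horizontalAt_ne_zero (S : AlmostThreeContactMetric I M) (hE : 3 < finrank ℝ E)
    (x : M) : ∃ v, S.HorizontalAt x v ∧ v ≠ 0 := by
  let L : TangentSpace I x →ₗ[ℝ] Fin 3 → ℝ := LinearMap.pi fun i ↦ (S.η i x).toLinearMap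
  have hL : LinearMap.ker L ≠ ⊥ := by
    refine LinearMap.ker_ne_bot_of_finrank_lt ?_
    rw [finrank_fin_fun]
    exact hE
  obtain ⟨v, hv, hne⟩ := Submodule.exists_mem_ne_zero_of_ne_bot hL
  exact ⟨v, fun i ↦ congrFun hv i, hne⟩

variable [T2Space M]

lemma IsReebKillingFunction.unique (hE : 3 < finrank ℝ E) (h : S.IsReebKillingFunction β)
    (h' : S.IsReebKillingFunction β') : β = β' := by
  ext x
  obtain ⟨v, hv, hne⟩ := S.exists_horizontalAt_ne_zero hE x
  obtain ⟨X, hX, hXx⟩ := exists_smoothField_eq x v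
  have hX' := S.isHorizontal_hor hX
  have h1 := (h.offDiag 0 _ _ hX' (hX'.applyEnd 2) x).1
  have h2 := (h'.offDiag 0 _ _ hX' (hX'.applyEnd 2) x).1
  rw [h1] at h2
  simp only [fundForm, applyEnd, zero_add, hXx, hv.hor_eq, hv.φ_φ] at h2
  rw [map_neg] at h2
  exact mul_right_cancel₀ (neg_ne_zero.2 (S.g.pos x v hne).ne') h2

lemma IsCanonicalConnection.cov_eq (h : S.IsCanonicalConnection cov β)
    (h' : S.IsCanonicalConnection cov' β) {x : M} {Y : Π x : M, TangentSpace I x}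
    (hY : MDiffAt (T% Y) x) : cov Y x = cov' Y x := by
  set B := cov.isCovariantDerivativeOnUniv.difference cov'.isCovariantDerivativeOnUniv x
  have hB : ∀ {Z : Π x : M, TangentSpace I x}, MDiffAt (T% Z) x → B (Z x) = cov Z x - cov' Z x :=
    fun hZ ↦ IsCovariantDerivativeOn.difference_apply _ _ (hx := Set.mem_univ x) hZ
  set b : TangentSpace I x → TangentSpace I x → TangentSpace I x → ℝ :=
    fun u v w ↦ S.g.inner x (B v u) w with hb
  have hb₂₃ : ∀ u v w, b u v w = -b u w v := by
    intro u v w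
    obtain ⟨U, hU, rfl⟩ := exists_smoothField_eq x u
    obtain ⟨V, hV, rfl⟩ := exists_smoothField_eq x v
    obtain ⟨W, hW, rfl⟩ := exists_smoothField_eq x w
    have e1 := h.metricSkew.metric U V W hU hV hW x
    have e2 := h'.metricSkew.metric U V W hU hV hW x
    simp only [hb, hB (hV.mdifferentiableAt x), hB (hW.mdifferentiableAt x), sub_apply, map_sub]
    rw [e1, S.g.symm x (V x), S.g.symm x (V x)] at e2
    linarith
  have ht : ∀ u v w, b u v w - b v u w =
      torsion₃ I S.g cov x u v w - torsion₃ I S.g cov' x u v w := by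
    intro u v w
    obtain ⟨U, hU, rfl⟩ := exists_smoothField_eq x u
    obtain ⟨V, hV, rfl⟩ := exists_smoothField_eq x v
    simp only [hb, hB (hV.mdifferentiableAt x), hB (hU.mdifferentiableAt x), sub_apply, map_sub,
      torsion₃, CovariantDerivative.torsion_apply _ (hU.mdifferentiableAt x)
      (hV.mdifferentiableAt x)]
    ring
  have hb₁₂ : ∀ u v w, b u v w = -b v u w := by
    intro u v w
    have t1 := ht u v w
    have t2 := ht w u v
    have t3 := ht v w u
    have a1 := h.metricSkew.skew₁₂ x w u v
    have a2 := h.metricSkew.skew₂₃ x u w v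
    have a3 := h.metricSkew.skew₂₃ x v w u
    have a4 := h.metricSkew.skew₁₂ x u v w
    have a1' := h'.metricSkew.skew₁₂ x w u v
    have a2' := h'.metricSkew.skew₂₃ x u w v
    have a3' := h'.metricSkew.skew₂₃ x v w u
    have a4' := h'.metricSkew.skew₁₂ x u v w
    linarith [hb₂₃ u v w, hb₂₃ v u w, hb₂₃ w u v]
  have hbξ : ∀ i u w, b u (S.ξ i x) w = 0 := by
    intro i u w
    simp [hb, hB ((S.smooth_ξ i).mdifferentiableAt x), h.cov_ξ, h'.cov_ξ]
  have hbφ : ∀ u v w, b u (S.φ 0 x v) w = -b u v (S.φ 0 x w) := by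
    intro u v w
    obtain ⟨V, hV, rfl⟩ := exists_smoothField_eq x v
    have e1 := cov_applyEnd (cov := cov) (S.isSmoothEnd_φ 0) hV x u
    have e2 := cov_applyEnd (cov := cov') (S.isSmoothEnd_φ 0) hV x u
    have e3 := hB (((S.isSmoothEnd_φ 0).applyEnd hV).mdifferentiableAt x)
    simp only [applyEnd] at e3
    rw [h.endDeriv_φ] at e1
    rw [h'.endDeriv_φ] at e2
    simp only [hb, e3, hB (hV.mdifferentiableAt x), sub_apply]
    erw [e1, e2]
    rw [add_sub_add_left_eq_sub, ← map_sub, S.φ_skew]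
  have hbhor : ∀ u v w, b u v (S.φ 0 x w) = 0 := by
    intro u v w
    linarith [hb₁₂ (S.φ 0 x u) v w, hbφ v u w, hb₁₂ v u (S.φ 0 x w), hb₂₃ (S.φ 0 x u) v w,
      hb₁₂ (S.φ 0 x u) w v, hbφ w u v, hb₁₂ w u (S.φ 0 x v), hb₂₃ u w (S.φ 0 x v), hbφ u v w]
  ext u
  refine eq_of_inner_eq S.g fun w ↦ ?_
  have hzero : b u (Y x) w = 0 := by
    have e := hbhor u (Y x) (S.φ 0 x w)
    have e2 := hbξ 0 u (Y x)
    rw [hb₂₃] at e2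
    rw [S.φ_sq] at e
    simp only [hb, map_add, map_neg, map_smul] at e e2 ⊢
    rw [smul_eq_mul] at e
    linear_combination -e - S.η 0 x w * e2
  simp only [hb, hB hY, sub_apply, map_sub] at hzero
  linarith

end Uniqueness

end AlmostThreeContactMetric

section ConnectionsWithTorsion

variable {E : Type*} [NormedAddCommGroup E] [NormedSpace ℝ E] [FiniteDimensional ℝ E]
  {H : Type*} [TopologicalSpace H] {I : ModelWithCorners ℝ E H}
  {M : Type*} [TopologicalSpace M] [ChartedSpace H M] [IsManifold I ∞ M]
  {g : ContMDiffRiemannianMetric I ∞ E (fun x : M ↦ TangentSpace I x)}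

lemma isMetricSkewTorsion_leviCivita [T2Space M] :
    IsMetricSkewTorsion I g (leviCivita g) where
  smooth := contMDiff_leviCivita g
  metric X Y Z hX hY hZ x := leviCivita_metric g (hX.mdifferentiableAt x) (hY.mdifferentiableAt x)
    (hZ.mdifferentiableAt x)
  skew₁₂ := by simp [torsion₃, leviCivita_torsion]
  skew₂₃ := by simp [torsion₃, leviCivita_torsion]

variable (g) in
lemma exists_clm_of_skew {x : M}
    {t : TangentSpace I x → TangentSpace I x → TangentSpace I x → ℝ}
    (hadd : ∀ u u' v w, t (u + u') v w = t u v w + t u' v w)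
    (hsmul : ∀ (a : ℝ) u v w, t (a • u) v w = a * t u v w)
    (h₁₂ : ∀ u v w, t u v w = -t v u w) (h₂₃ : ∀ u v w, t u v w = -t u w v) :
    ∃ A : TangentSpace I x →L[ℝ] TangentSpace I x →L[ℝ] TangentSpace I x,
      ∀ u v w, g.inner x (A v u) w = t u v w := by
  have hadd₂ : ∀ u v v' w, t u (v + v') w = t u v w + t u v' w := fun u v v' w ↦ by
    rw [h₁₂, hadd, h₁₂ v, h₁₂ v']; ring
  have hsmul₂ : ∀ (a : ℝ) u v w, t u (a • v) w = a * t u v w := fun a u v w ↦ by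
    rw [h₁₂, hsmul, h₁₂ v]; ring
  have hadd₃ : ∀ u v w w', t u v (w + w') = t u v w + t u v w' := fun u v w w' ↦ by
    rw [h₂₃, hadd₂, h₂₃ u w, h₂₃ u w']; ring
  have hsmul₃ : ∀ (a : ℝ) u v w, t u v (a • w) = a * t u v w := fun a u v w ↦ by
    rw [h₂₃, hsmul₂, h₂₃ u w]; ring
  let α (u v : TangentSpace I x) : TangentSpace I x →L[ℝ] ℝ :=
    LinearMap.toContinuousLinearMap
      { toFun := t u v, map_add' := hadd₃ u v, map_smul' := fun a w ↦ hsmul₃ a u v w }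
  have hα : ∀ u v w, g.inner x (sharp g x (α u v)) w = t u v w := fun u v w ↦
    inner_sharp g x (α u v) w
  let B (v : TangentSpace I x) : TangentSpace I x →L[ℝ] TangentSpace I x :=
    LinearMap.toContinuousLinearMap
      { toFun := fun u ↦ sharp g x (α u v)
        map_add' := fun u u' ↦ eq_of_inner_eq g fun w ↦ by
          rw [map_add, add_apply, hα, hα, hα, hadd]
        map_smul' := fun a u ↦ eq_of_inner_eq g fun w ↦ by
          rw [RingHom.id_apply, map_smul, smul_apply, hα, hα, hsmul, smul_eq_mul] }
  have hB : ∀ u v w, g.inner x (B v u) w = t u v w := hα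
  refine ⟨LinearMap.toContinuousLinearMap
      { toFun := B
        map_add' := fun v v' ↦ ?_
        map_smul' := fun a v ↦ ?_ }, hB⟩
  · ext u
    refine eq_of_inner_eq g fun w ↦ ?_
    rw [add_apply, map_add, add_apply, hB, hB, hB, hadd₂]
  · ext u
    refine eq_of_inner_eq g fun w ↦ ?_
    rw [RingHom.id_apply, smul_apply, map_smul, smul_apply, hB, hB, hsmul₂, smul_eq_mul]

/-- Every smooth three-form is the torsion of a metric connection, which differs from the
Levi-Civita connection by half of it. -/
lemma exists_connection_of_torsion [T2Space M]
    {t : Π x : M, TangentSpace I x → TangentSpace I x → TangentSpace I x → ℝ}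
    (hadd : ∀ x u u' v w, t x (u + u') v w = t x u v w + t x u' v w)
    (hsmul : ∀ x (a : ℝ) u v w, t x (a • u) v w = a * t x u v w)
    (h₁₂ : ∀ x u v w, t x u v w = -t x v u w) (h₂₃ : ∀ x u v w, t x u v w = -t x u w v)
    (hsm : ∀ X Y Z : Π x : M, TangentSpace I x, IsSmoothField I X → IsSmoothField I Y →
      IsSmoothField I Z → ContMDiff I 𝓘(ℝ) ∞ (fun x ↦ t x (X x) (Y x) (Z x))) :
    ∃ cov : CovariantDerivative I E (TangentSpace I : M → Type _),
      IsMetricSkewTorsion I g cov ∧ (∀ x u v w, torsion₃ I g cov x u v w = t x u v w) ∧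
      ∀ (Y : Π x : M, TangentSpace I x) (x : M) (u w : TangentSpace I x),
        g.inner x (cov Y x u) w = g.inner x (leviCivita g Y x u) w + 1 / 2 * t x u (Y x) w := by
  choose A hA using fun x ↦ exists_clm_of_skew g (hadd x) (hsmul x) (h₁₂ x) (h₂₃ x)
  let cov := (leviCivita g).addOneForm (fun x ↦ (1 / 2 : ℝ) • A x)
  have hcov : ∀ (Y : Π x : M, TangentSpace I x) (x : M) (u w : TangentSpace I x),
      g.inner x (cov Y x u) w = g.inner x (leviCivita g Y x u) w + 1 / 2 * t x u (Y x) w := by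
    intro Y x u w
    rw [← hA]
    simp [cov, CovariantDerivative.addOneForm]
  have htor : ∀ x u v w, torsion₃ I g cov x u v w = t x u v w := by
    intro x u v w
    obtain ⟨U, hU, rfl⟩ := exists_smoothField_eq x u
    obtain ⟨V, hV, rfl⟩ := exists_smoothField_eq x v
    have h0 := CovariantDerivative.torsion_apply (leviCivita g) (hU.mdifferentiableAt x)
      (hV.mdifferentiableAt x)
    rw [leviCivita_torsion] at h0
    have h1 := congrArg (fun z ↦ g.inner x z w) h0
    simp only [Pi.zero_apply, zero_apply, map_zero, map_sub, sub_apply] at h1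
    rw [torsion₃, CovariantDerivative.torsion_apply cov (hU.mdifferentiableAt x)
      (hV.mdifferentiableAt x)]
    simp only [map_sub, sub_apply, hcov]
    linarith [h₁₂ x (U x) (V x) w]
  refine ⟨cov, ⟨⟨⟨?_⟩⟩, ?_, ?_, ?_⟩, htor, hcov⟩
  · intro Y hY
    have hY' : IsSmoothField I Y := contMDiffOn_univ.1 (by simpa using! hY)
    rw [contMDiffOn_univ]
    refine isSmoothEnd_of_apply fun X hX ↦ isSmoothField_of_inner g fun Z hZ ↦ ?_
    simp only [hcov]
    exact (contMDiff_inner g (isMetricSkewTorsion_leviCivita.smooth_apply hX hY') hZ).add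
      (contMDiff_const.mul (hsm _ _ _ hX hY' hZ))
  · intro X Y Z hX hY hZ x
    rw [isMetricSkewTorsion_leviCivita.metric X Y Z hX hY hZ, g.symm x (Y x) (cov Z x (X x)), hcov,
      hcov, g.symm x (Y x)]
    linarith [h₂₃ x (X x) (Y x) (Z x)]
  · intro x u v w
    rw [htor, htor, h₁₂]
  · intro x u v w
    rw [htor, htor, h₂₃]

lemma IsMetricSkewTorsion.endDeriv_skew [T2Space M]
    {cov : CovariantDerivative I E (TangentSpace I : M → Type _)}
    (hcov : IsMetricSkewTorsion I g cov)
    {φ : Π x : M, TangentSpace I x →L[ℝ] TangentSpace I x} (hφ : IsSmoothEnd φ)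
    (hsk : ∀ x u v, g.inner x (φ x u) v = -g.inner x u (φ x v)) (x : M)
    (u v w : TangentSpace I x) :
    g.inner x (endDeriv cov hφ x v u) w = -g.inner x (endDeriv cov hφ x w u) v := by
  obtain ⟨U, hU, rfl⟩ := exists_smoothField_eq x u
  obtain ⟨V, hV, rfl⟩ := exists_smoothField_eq x v
  obtain ⟨W, hW, rfl⟩ := exists_smoothField_eq x w
  have e1 := hcov.metric U _ W hU (hφ.applyEnd hV) hW x
  have e2 := hcov.metric U V _ hU hV (hφ.applyEnd hW) x
  have e3 : (fun y ↦ g.inner y (applyEnd I φ V y) (W y)) =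
      fun y ↦ -g.inner y (V y) (applyEnd I φ W y) := by
    ext y
    exact hsk y _ _
  have e4 : dirDeriv I U (fun y ↦ -g.inner y (V y) (applyEnd I φ W y)) x =
      -dirDeriv I U (fun y ↦ g.inner y (V y) (applyEnd I φ W y)) x := by
    simp [dirDeriv, mvfderiv_fun_neg]
  rw [e3, e4, e2, cov_applyEnd hφ hV, cov_applyEnd hφ hW] at e1
  simp only [applyEnd, map_add, add_apply, hsk] at e1
  rw [g.symm x _ (V x)]
  linarith

end ConnectionsWithTorsion

namespace AlmostThreeContactMetric

section Existence

variable {E : Type*} [NormedAddCommGroup E] [NormedSpace ℝ E] [FiniteDimensional ℝ E]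
  {H : Type*} [TopologicalSpace H] {I : ModelWithCorners ℝ E H}
  {M : Type*} [TopologicalSpace M] [ChartedSpace H M] [IsManifold I ∞ M]
  (S : AlmostThreeContactMetric I M)

/-- The tensor whose restriction to `𝓗` is `N_{φ_i} - dΦ_i ∘ φ_i`, in terms of the Levi-Civita
derivative of `φ_i`. -/
def horTorsion (i : Fin 3) (x : M) (u v w : TangentSpace I x) : ℝ :=
  S.g.inner x (endDeriv (leviCivita S.g) (S.isSmoothEnd_φ i) x v u) (S.φ i x w)
    - S.g.inner x (endDeriv (leviCivita S.g) (S.isSmoothEnd_φ i) x u v) (S.φ i x w)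
    - S.g.inner x (endDeriv (leviCivita S.g) (S.isSmoothEnd_φ i) x u (S.φ i x w)) v

/-- The two-form `dη_i + 2β η_{i+1} ∧ η_{i+2}`, for a Killing field `ξ_i`. -/
def reebTorsion (β : M → ℝ) (i : Fin 3) (x : M) (u v : TangentSpace I x) : ℝ :=
  2 * S.g.inner x (leviCivita S.g (S.ξ i) x u) v
    + 2 * β x * (S.η (i + 1) x u * S.η (i + 2) x v - S.η (i + 2) x u * S.η (i + 1) x v)

/-- The torsion three-form of the canonical connection. -/
def canonicalTorsion (β : M → ℝ) (x : M) (u v w : TangentSpace I x) : ℝ :=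
  S.horTorsion 0 x (S.hor x u) (S.hor x v) (S.hor x w)
    + ∑ i, (S.η i x w * S.reebTorsion β i x u v
      + S.η i x v * S.reebTorsion β i x (S.hor x w) u
      + S.η i x u * S.reebTorsion β i x (S.hor x v) (S.hor x w))

variable {S} {β : M → ℝ} {X Y Z : Π x : M, TangentSpace I x}

lemma canonicalTorsion_add (x : M) (u u' v w : TangentSpace I x) :
    S.canonicalTorsion β x (u + u') v w =
      S.canonicalTorsion β x u v w + S.canonicalTorsion β x u' v w := by
  simp only [canonicalTorsion, horTorsion, reebTorsion, map_add, add_apply, Fin.sum_univ_three]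
  ring

lemma canonicalTorsion_smul (x : M) (a : ℝ) (u v w : TangentSpace I x) :
    S.canonicalTorsion β x (a • u) v w = a * S.canonicalTorsion β x u v w := by
  simp only [canonicalTorsion, horTorsion, reebTorsion, map_smul, smul_apply, Fin.sum_univ_three,
    smul_eq_mul]
  ring

variable [T2Space M]

lemma contMDiff_horTorsion (i : Fin 3) (hX : IsSmoothField I X) (hY : IsSmoothField I Y)
    (hZ : IsSmoothField I Z) :
    ContMDiff I 𝓘(ℝ) ∞ (fun x ↦ S.horTorsion i x (X x) (Y x) (Z x)) := by
  have hP : ∀ {U V : Π x : M, TangentSpace I x}, IsSmoothField I U → IsSmoothField I V →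
      IsSmoothField I
        (fun x ↦ endDeriv (leviCivita S.g) (S.isSmoothEnd_φ i) x (U x) (V x)) := by
    intro U V hU hV
    simp only [endDeriv_apply (S.isSmoothEnd_φ i) hU, covDerivEnd]
    exact (isMetricSkewTorsion_leviCivita.smooth_apply hV ((S.isSmoothEnd_φ i).applyEnd hU)).sub
      ((S.isSmoothEnd_φ i).apply (isMetricSkewTorsion_leviCivita.smooth_apply hV hU))
  have hφZ := (S.isSmoothEnd_φ i).apply hZ
  exact ((contMDiff_inner S.g (hP hY hX) hφZ).sub (contMDiff_inner S.g (hP hX hY) hφZ)).sub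
    (contMDiff_inner S.g (hP hX hφZ) hY)

lemma contMDiff_reebTorsion (hβ : ContMDiff I 𝓘(ℝ) ∞ β) (i : Fin 3) (hX : IsSmoothField I X)
    (hY : IsSmoothField I Y) :
    ContMDiff I 𝓘(ℝ) ∞ (fun x ↦ S.reebTorsion β i x (X x) (Y x)) := by
  have hη := fun (j : Fin 3) {U : Π x : M, TangentSpace I x} (hU : IsSmoothField I U) ↦
    (S.isSmoothForm_η j).apply hU
  exact (contMDiff_const.mul (contMDiff_inner S.g
    (isMetricSkewTorsion_leviCivita.smooth_apply hX (S.smooth_ξ i)) hY)).add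
    ((contMDiff_const.mul hβ).mul (((hη _ hX).mul (hη _ hY)).sub ((hη _ hX).mul (hη _ hY))))

lemma contMDiff_canonicalTorsion (hβ : ContMDiff I 𝓘(ℝ) ∞ β) (hX : IsSmoothField I X)
    (hY : IsSmoothField I Y) (hZ : IsSmoothField I Z) :
    ContMDiff I 𝓘(ℝ) ∞ (fun x ↦ S.canonicalTorsion β x (X x) (Y x) (Z x)) := by
  have hη := fun (j : Fin 3) {U : Π x : M, TangentSpace I x} (hU : IsSmoothField I U) ↦
    (S.isSmoothForm_η j).apply hU
  refine (contMDiff_horTorsion 0 (S.isSmoothField_hor hX) (S.isSmoothField_hor hY)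
    (S.isSmoothField_hor hZ)).add (ContMDiff.sum fun i _ ↦ ?_)
  exact (((hη i hZ).mul (contMDiff_reebTorsion hβ i hX hY)).add
    ((hη i hY).mul (contMDiff_reebTorsion hβ i (S.isSmoothField_hor hZ) hX))).add
    ((hη i hX).mul (contMDiff_reebTorsion hβ i (S.isSmoothField_hor hY) (S.isSmoothField_hor hZ)))

lemma reebTorsion_skew (hK : ∀ i, IsKilling I S.g (S.ξ i)) (i : Fin 3) (x : M)
    (u v : TangentSpace I x) : S.reebTorsion β i x u v = -S.reebTorsion β i x v u := by
  obtain ⟨U, hU, rfl⟩ := exists_smoothField_eq x u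
  obtain ⟨V, hV, rfl⟩ := exists_smoothField_eq x v
  have h := hK i U V hU hV x
  rw [isMetricSkewTorsion_leviCivita.lieDerivMetric_eq (S.smooth_ξ i) hU hV] at h
  simp only [reebTorsion]
  linear_combination 2 * h

lemma reebTorsion_ξ (i j : Fin 3) (x : M) (u : TangentSpace I x) :
    S.reebTorsion β i x u (S.ξ j x) = -S.reebTorsion β j x u (S.ξ i x) := by
  have h := inner_cov_ξ_add (isMetricSkewTorsion_leviCivita (g := S.g)) i j x u
  rw [S.g.symm x (S.ξ i x)] at h
  simp only [reebTorsion]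
  obtain rfl | rfl | rfl : j = i ∨ j = i + 1 ∨ i = j + 1 := by omega
  · rw [S.η_ξ_eq, S.η_ξ_eq, if_neg (by omega), if_neg (by omega)]
    linear_combination 2 * h
  · simp only [S.η_ξ_eq, show i + 1 + 1 = i + 2 by omega, show i + 1 + 2 = i by omega, if_true]
    rw [if_neg (by omega), if_neg (by omega)]
    linear_combination 2 * h
  · simp only [S.η_ξ_eq, show j + 1 + 1 = j + 2 by omega, show j + 1 + 2 = j by omega, if_true]
    rw [if_neg (by omega), if_neg (by omega)]
    linear_combination 2 * h

lemma sum_reebTorsion_vertical (x : M) (a u v : TangentSpace I x) :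
    ∑ i, (S.η i x v * (S.reebTorsion β i x a u - S.reebTorsion β i x a (S.hor x u))
      + S.η i x u * (S.reebTorsion β i x a v - S.reebTorsion β i x a (S.hor x v))) = 0 := by
  have h1 : ∀ i (w : TangentSpace I x), S.reebTorsion β i x a w - S.reebTorsion β i x a (S.hor x w)
      = ∑ j, S.η j x w * S.reebTorsion β i x a (S.ξ j x) := by
    intro i w
    simp only [reebTorsion, hor_apply, map_sub, Fin.sum_univ_three, map_add, map_smul, smul_eq_mul]
    ring
  simp only [h1, Fin.sum_univ_three]
  have h2 := fun i j ↦ reebTorsion_ξ (S := S) (β := β) i j x a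
  have d := fun i ↦ h2 i i
  linear_combination S.η 0 x v * S.η 0 x u * d 0 + S.η 1 x v * S.η 1 x u * d 1
    + S.η 2 x v * S.η 2 x u * d 2
    + (S.η 0 x v * S.η 1 x u + S.η 0 x u * S.η 1 x v) * h2 0 1
    + (S.η 0 x v * S.η 2 x u + S.η 0 x u * S.η 2 x v) * h2 0 2
    + (S.η 1 x v * S.η 2 x u + S.η 1 x u * S.η 2 x v) * h2 1 2

end Existence

end AlmostThreeContactMetric

namespace AlmostThreeContactMetric

section CanonicalTorsion

variable {E : Type*} [NormedAddCommGroup E] [NormedSpace ℝ E] [FiniteDimensional ℝ E]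
  {H : Type*} [TopologicalSpace H] {I : ModelWithCorners ℝ E H}
  {M : Type*} [TopologicalSpace M] [ChartedSpace H M] [IsManifold I ∞ M]
  {S : AlmostThreeContactMetric I M}
  {cov : CovariantDerivative I E (TangentSpace I : M → Type _)}
  {β : M → ℝ} {X Y Z : Π x : M, TangentSpace I x}

lemma HorizontalAt.exists_isHorizontal_eq [T2Space M] {x : M} {v : TangentSpace I x}
    (hv : S.HorizontalAt x v) : ∃ V, S.IsHorizontal V ∧ V x = v := by
  obtain ⟨W, hW, rfl⟩ := exists_smoothField_eq x v
  exact ⟨_, S.isHorizontal_hor hW, hv.hor_eq⟩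

lemma inner_endDeriv_φ [T2Space M] (i : Fin 3) {x : M} {v w : TangentSpace I x}
    (hv : S.HorizontalAt x v) (hw : S.HorizontalAt x w) (u : TangentSpace I x) :
    S.g.inner x (endDeriv cov (S.isSmoothEnd_φ i) x (S.φ i x v) u) w =
      S.g.inner x (endDeriv cov (S.isSmoothEnd_φ i) x v u) (S.φ i x w) := by
  obtain ⟨V, hV, rfl⟩ := hv.exists_isHorizontal_eq
  have e1 := cov_applyEnd (cov := cov) (S.isSmoothEnd_φ i) (hV.applyEnd i).1 x u
  have e2 : applyEnd I (S.φ i) (applyEnd I (S.φ i) V) = (-1 : ℝ) • V := by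
    ext y
    simp [applyEnd, (hV.horizontalAt y).φ_φ i]
  rw [e2, cov.isCovariantDerivativeOnUniv.smul_const _ (hV.1.mdifferentiableAt x),
    cov_applyEnd (S.isSmoothEnd_φ i) hV.1] at e1
  have e3 := congrArg (fun z ↦ S.g.inner x z w) e1
  have e4 := S.compatible i x (cov V x u) w
  rw [hw] at e4
  simp only [map_add, add_apply, S.φ_skew i x (endDeriv _ _ _ _ _) w, map_smul, smul_apply,
    smul_eq_mul, S.φ_skew i x (S.φ i x _) w, applyEnd, e4] at e3
  linarith

lemma N_eq_leviCivita (i : Fin 3) (hX : S.IsHorizontal X) (hY : S.IsHorizontal Y)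
    (hZ : S.IsHorizontal Z) (x : M) :
    S.N i X Y Z x =
      S.g.inner x (endDeriv (leviCivita S.g) (S.isSmoothEnd_φ i) x (Y x) (S.φ i x (X x))) (Z x)
      - S.g.inner x (endDeriv (leviCivita S.g) (S.isSmoothEnd_φ i) x (X x) (S.φ i x (Y x))) (Z x)
      + S.g.inner x (endDeriv (leviCivita S.g) (S.isSmoothEnd_φ i) x (Y x) (X x)) (S.φ i x (Z x))
      - S.g.inner x (endDeriv (leviCivita S.g) (S.isSmoothEnd_φ i) x (X x) (Y x))
        (S.φ i x (Z x)) := by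
  rw [N, nijenhuis_eq (cov := leviCivita S.g) (S.isSmoothEnd_φ i) _ hX.1 hY.1, leviCivita_torsion]
  simp only [Pi.zero_apply, zero_apply, map_zero, map_add, map_sub, add_apply, sub_apply, map_smul,
    smul_apply, inner_ξ_eq_zero (hZ.horizontalAt x), S.φ_skew, smul_zero]
  ring

lemma canonicalTorsion_ξ (i : Fin 3) (x : M) (u v : TangentSpace I x) :
    S.canonicalTorsion β x u v (S.ξ i x) = S.reebTorsion β i x u v := by
  have h1 : S.horTorsion 0 x (S.hor x u) (S.hor x v) 0 = 0 := by simp [horTorsion]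
  have h2 : ∀ j (v : TangentSpace I x), S.reebTorsion β j x v 0 = 0 := by simp [reebTorsion]
  have h3 : ∀ j (v : TangentSpace I x), S.reebTorsion β j x 0 v = 0 := by simp [reebTorsion]
  simp [canonicalTorsion, hor_ξ, h1, h2, h3, η_ξ_eq]

lemma canonicalTorsion_of_horizontalAt {x : M} {u v w : TangentSpace I x}
    (hu : S.HorizontalAt x u) (hv : S.HorizontalAt x v) (hw : S.HorizontalAt x w) :
    S.canonicalTorsion β x u v w = S.horTorsion 0 x u v w := by
  simp [canonicalTorsion, hu.hor_eq, hv.hor_eq, hw.hor_eq, hu _, hv _, hw _]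

variable [T2Space M]

lemma horTorsion_skew₁₂ (i : Fin 3) (x : M) (u v w : TangentSpace I x) :
    S.horTorsion i x u v w = -S.horTorsion i x v u w := by
  have h := isMetricSkewTorsion_leviCivita.endDeriv_skew (S.isSmoothEnd_φ i) (S.φ_skew i) x
    (S.φ i x w) u v
  simp only [horTorsion]
  linarith

lemma horTorsion_eq (i : Fin 3) (hX : S.IsHorizontal X) (hY : S.IsHorizontal Y)
    (hZ : S.IsHorizontal Z) (x : M) :
    S.horTorsion i x (X x) (Y x) (Z x) = S.N i X Y Z x - extDerivTwo I (fundForm I S.g (S.φ i))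
        (applyEnd I (S.φ i) X) (applyEnd I (S.φ i) Y) (applyEnd I (S.φ i) Z) x := by
  have hs := isMetricSkewTorsion_leviCivita.endDeriv_skew (S.isSmoothEnd_φ i) (S.φ_skew i) x
  have hc : ∀ u {v w : TangentSpace I x}, S.HorizontalAt x v → S.HorizontalAt x w →
      S.g.inner x (S.φ i x w)
        (endDeriv (leviCivita S.g) (S.isSmoothEnd_φ i) x (S.φ i x v) u) =
      -S.g.inner x (endDeriv (leviCivita S.g) (S.isSmoothEnd_φ i) x v u) w := by
    intro u v w hv hw
    rw [S.g.symm, inner_endDeriv_φ i hv (hw.φ i), hw.φ_φ, map_neg]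
  rw [N_eq_leviCivita i hX hY hZ, isMetricSkewTorsion_leviCivita.extDerivTwo_eq (S.isSmoothEnd_φ i)
    (S.φ_skew i) (hX.applyEnd i).1 (hY.applyEnd i).1 (hZ.applyEnd i).1]
  simp only [applyEnd, horTorsion, torsion₃, leviCivita_torsion,
    hc _ (hX.horizontalAt x) (hZ.horizontalAt x), hc _ (hY.horizontalAt x) (hX.horizontalAt x),
    hc _ (hZ.horizontalAt x) (hY.horizontalAt x), Pi.zero_apply, zero_apply, map_zero]
  linarith [hs (S.φ i x (X x)) (Y x) (Z x), hs (S.φ i x (Z x)) (X x) (Y x)]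

lemma horTorsion_skew₂₃ (hS : S.IsCanonical) (i : Fin 3) {x : M} {u v w : TangentSpace I x}
    (hu : S.HorizontalAt x u) (hv : S.HorizontalAt x v) (hw : S.HorizontalAt x w) :
    S.horTorsion i x u v w = -S.horTorsion i x u w v := by
  obtain ⟨U, hU, rfl⟩ := hu.exists_isHorizontal_eq
  obtain ⟨V, hV, rfl⟩ := hv.exists_isHorizontal_eq
  obtain ⟨W, hW, rfl⟩ := hw.exists_isHorizontal_eq
  have h := (hS.skew i U V W hU hV hW x).2
  rw [N_eq_leviCivita i hU hV hW, N_eq_leviCivita i hU hW hV] at h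
  have hs := isMetricSkewTorsion_leviCivita.endDeriv_skew (S.isSmoothEnd_φ i) (S.φ_skew i) x
  simp only [horTorsion]
  linarith [hs (S.φ i x (U x)) (V x) (W x), hs (S.φ i x (V x)) (U x) (W x),
    hs (S.φ i x (W x)) (U x) (V x)]

lemma horTorsion_eq_horTorsion (hS : S.IsCanonical) (i j : Fin 3) {x : M}
    {u v w : TangentSpace I x} (hu : S.HorizontalAt x u) (hv : S.HorizontalAt x v)
    (hw : S.HorizontalAt x w) : S.horTorsion i x u v w = S.horTorsion j x u v w := by
  obtain ⟨U, hU, rfl⟩ := hu.exists_isHorizontal_eq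
  obtain ⟨V, hV, rfl⟩ := hv.exists_isHorizontal_eq
  obtain ⟨W, hW, rfl⟩ := hw.exists_isHorizontal_eq
  rw [horTorsion_eq i hU hV hW, horTorsion_eq j hU hV hW, hS.independent i j U V W hU hV hW]

lemma canonicalTorsion_skew₂₃ (hS : S.IsCanonical) (x : M) (u v w : TangentSpace I x) :
    S.canonicalTorsion β x u v w = -S.canonicalTorsion β x u w v := by
  have h1 := horTorsion_skew₂₃ hS 0 (S.horizontalAt_hor x u) (S.horizontalAt_hor x v)
    (S.horizontalAt_hor x w)
  have h2 := sum_reebTorsion_vertical (S := S) (β := β) x u v w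
  have h3 := fun i ↦ reebTorsion_skew (β := β) hS.killing i x
  simp only [canonicalTorsion, Fin.sum_univ_three] at h2 ⊢
  rw [h1]
  simp only [h3 _ (S.hor x v) u, h3 _ (S.hor x w) u, h3 _ (S.hor x v) (S.hor x w)]
  linear_combination h2

lemma canonicalTorsion_skew₁₂ (hS : S.IsCanonical) (x : M) (u v w : TangentSpace I x) :
    S.canonicalTorsion β x u v w = -S.canonicalTorsion β x v u w := by
  have h1 := horTorsion_skew₁₂ (S := S) 0 x (S.hor x u) (S.hor x v) (S.hor x w)
  have h2 := sum_reebTorsion_vertical (S := S) (β := β) x (S.hor x w) u v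
  have h3 := fun i ↦ reebTorsion_skew (β := β) hS.killing i x
  simp only [canonicalTorsion, Fin.sum_univ_three] at h2 ⊢
  rw [h1]
  simp only [h3 _ u v, h3 _ (S.hor x v) (S.hor x w), h3 _ (S.hor x u) (S.hor x w)]
  linear_combination h2

end CanonicalTorsion

end AlmostThreeContactMetric

namespace AlmostThreeContactMetric

section ConstructionOfConnection

variable {E : Type*} [NormedAddCommGroup E] [NormedSpace ℝ E] [FiniteDimensional ℝ E]
  {H : Type*} [TopologicalSpace H] {I : ModelWithCorners ℝ E H}
  {M : Type*} [TopologicalSpace M] [ChartedSpace H M] [IsManifold I ∞ M]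
  {S : AlmostThreeContactMetric I M}
  {cov : CovariantDerivative I E (TangentSpace I : M → Type _)} {β : M → ℝ}

lemma endDeriv_φ_ξ
    (hξ : ∀ i x u, cov (S.ξ i) x u =
      β x • (S.η (i + 2) x u • S.ξ (i + 1) x - S.η (i + 1) x u • S.ξ (i + 2) x))
    (i j : Fin 3) (x : M) (u : TangentSpace I x) :
    endDeriv cov (S.isSmoothEnd_φ i) x (S.ξ j x) u =
      β x • (S.η (i + 2) x u • S.φ (i + 1) x (S.ξ j x)
        - S.η (i + 1) x u • S.φ (i + 2) x (S.ξ j x)) := by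
  have h1 := cov_applyEnd (cov := cov) (S.isSmoothEnd_φ i) (S.smooth_ξ j) x u
  have s11 : i + 1 + 1 = i + 2 := by omega
  have s12 : i + 1 + 2 = i := by omega
  have s21 : i + 2 + 1 = i := by omega
  have s22 : i + 2 + 2 = i + 1 := by omega
  have a1 := S.φ_ξ_pred (i + 1) x
  have a2 := S.φ_ξ_succ (i + 2) x
  have b1 := S.φ_ξ_pred (i + 2) x
  have b2 := S.φ_ξ_succ (i + 1) x
  have c1 := S.φ_ξ_pred i x
  have c2 := S.φ_ξ_succ i x
  simp only [s11, s12, s21, s22] at a1 a2 b1 b2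
  rw [← sub_eq_iff_eq_add] at h1
  rw [← h1]
  obtain rfl | rfl | rfl : j = i ∨ j = i + 1 ∨ j = i + 2 := by omega
  · have e : applyEnd I (S.φ j) (S.ξ j) = 0 := by
      ext y; exact S.φ_ξ_self j y
    rw [e, cov.zero, hξ]
    simp only [map_smul, map_sub, a1, a2, c1, c2, Pi.zero_apply, zero_apply]
    module
  · have e : applyEnd I (S.φ i) (S.ξ (i + 1)) = S.ξ (i + 2) := by
      ext y; exact S.φ_ξ_succ i y
    rw [e, hξ, hξ, s11, s12, s21, s22]
    simp only [map_smul, map_sub, b1, c1, S.φ_ξ_self]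
    module
  · have e : applyEnd I (S.φ i) (S.ξ (i + 2)) = (-1 : ℝ) • S.ξ (i + 1) := by
      ext y; simpa [applyEnd] using S.φ_ξ_pred i y
    rw [e, cov.isCovariantDerivativeOnUniv.smul_const _ ((S.smooth_ξ _).mdifferentiableAt x),
      smul_apply, hξ, hξ, s11, s12, s21, s22]
    simp only [map_smul, map_sub, b2, c2, S.φ_ξ_self]
    module

variable [T2Space M]

lemma cov_ξ_of_eq_leviCivita_add (hS : S.IsCanonical)
    (hcov : ∀ (Y : Π x : M, TangentSpace I x) (x : M) (u w : TangentSpace I x),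
      S.g.inner x (cov Y x u) w =
        S.g.inner x (leviCivita S.g Y x u) w + 1 / 2 * S.canonicalTorsion β x u (Y x) w)
    (i : Fin 3) (x : M) (u : TangentSpace I x) :
    cov (S.ξ i) x u =
      β x • (S.η (i + 2) x u • S.ξ (i + 1) x - S.η (i + 1) x u • S.ξ (i + 2) x) := by
  refine eq_of_inner_eq S.g fun w ↦ ?_
  rw [hcov, canonicalTorsion_skew₂₃ hS, canonicalTorsion_ξ, reebTorsion]
  simp only [map_smul, map_sub, smul_apply, sub_apply, S.g.symm x (S.ξ _ x), ← S.η_eq_inner,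
    smul_eq_mul]
  ring

lemma inner_endDeriv_ξ_of_horizontalAt (hβ : S.IsReebKillingFunction β)
    (hcov : IsMetricSkewTorsion I S.g cov)
    (hξ : ∀ i x v, S.HorizontalAt x v → cov (S.ξ i) x v = 0) (i j : Fin 3)
    {x : M} {v w : TangentSpace I x} (hv : S.HorizontalAt x v) (hw : S.HorizontalAt x w) :
    S.g.inner x (endDeriv cov (S.isSmoothEnd_φ i) x v (S.ξ j x)) w =
      β x * (S.η (i + 2) x (S.ξ j x) * S.g.inner x (S.φ (i + 1) x v) w
        - S.η (i + 1) x (S.ξ j x) * S.g.inner x (S.φ (i + 2) x v) w) := by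
  obtain ⟨V, hV, rfl⟩ := hv.exists_isHorizontal_eq
  obtain ⟨W, hW, rfl⟩ := hw.exists_isHorizontal_eq
  rw [← A_eq_of_cov_ξ hcov hξ i j hV hW x, S.η_ξ_eq, S.η_ξ_eq, S.φ_skew, S.φ_skew]
  obtain rfl | rfl | rfl : j = i ∨ j = i + 1 ∨ i = j + 1 := by omega
  · rw [hβ.diag j V W hV hW, if_neg (by omega), if_neg (by omega)]
    ring
  · rw [(hβ.offDiag i V W hV hW x).1, if_neg (by omega), if_pos rfl, fundForm]
    ring
  · have h := (hβ.offDiag j V W hV hW x).2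
    rw [fundForm] at h
    rw [show j + 1 + 2 = j by omega, show j + 1 + 1 = j + 2 by omega, if_pos rfl,
      if_neg (by omega)]
    linarith

lemma inner_endDeriv_of_horizontalAt (hS : S.IsCanonical)
    (hcov : ∀ (Y : Π x : M, TangentSpace I x) (x : M) (u w : TangentSpace I x),
      S.g.inner x (cov Y x u) w =
        S.g.inner x (leviCivita S.g Y x u) w + 1 / 2 * S.canonicalTorsion β x u (Y x) w)
    (i : Fin 3) {x : M} {u v w : TangentSpace I x} (hu : S.HorizontalAt x u)
    (hv : S.HorizontalAt x v) (hw : S.HorizontalAt x w) :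
    S.g.inner x (endDeriv cov (S.isSmoothEnd_φ i) x v u) w = 0 := by
  obtain ⟨V, hV, rfl⟩ := hv.exists_isHorizontal_eq
  have e1 : S.canonicalTorsion β x u (V x) (S.φ i x w) =
      -S.horTorsion i x u (S.φ i x w) (V x) := by
    rw [canonicalTorsion_of_horizontalAt hu hv (hw.φ i),
      horTorsion_eq_horTorsion hS 0 i hu hv (hw.φ i), horTorsion_skew₂₃ hS i hu hv (hw.φ i)]
  have e2 : S.canonicalTorsion β x u (S.φ i x (V x)) w = S.horTorsion i x u (S.φ i x (V x)) w := by
    rw [canonicalTorsion_of_horizontalAt hu (hv.φ i) hw,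
      horTorsion_eq_horTorsion hS 0 i hu (hv.φ i) hw]
  have hs := isMetricSkewTorsion_leviCivita.endDeriv_skew (S.isSmoothEnd_φ i) (S.φ_skew i) x
  have hc := fun u {v w : TangentSpace I x} (hv : S.HorizontalAt x v) (hw : S.HorizontalAt x w) ↦
    inner_endDeriv_φ (cov := leviCivita S.g) i hv hw u
  rw [endDeriv_apply _ hV.1, covDerivEnd, map_sub, sub_apply, S.φ_skew, hcov, hcov,
    cov_applyEnd (S.isSmoothEnd_φ i) hV.1, map_add, add_apply, S.φ_skew, applyEnd, e1, e2]
  simp only [horTorsion, hc _ hv (hw.φ i), hc _ hw (hv.φ i), hv.φ_φ, hw.φ_φ, map_neg]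
  linarith [hs u (V x) w, hs (S.φ i x (V x)) u (S.φ i x w), hs (S.φ i x w) u (S.φ i x (V x))]

lemma IsCanonical.exists_isCanonicalConnection (hS : S.IsCanonical) :
    ∃ cov β, S.IsCanonicalConnection cov β := by
  obtain ⟨β, hβ⟩ := hS.reebKilling
  obtain ⟨cov, hm, -, hcov⟩ := exists_connection_of_torsion (g := S.g)
    (t := S.canonicalTorsion β) canonicalTorsion_add canonicalTorsion_smul
    (canonicalTorsion_skew₁₂ hS) (canonicalTorsion_skew₂₃ hS)
    fun _ _ _ hX hY hZ ↦ contMDiff_canonicalTorsion hβ.smooth hX hY hZ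
  have hξ := cov_ξ_of_eq_leviCivita_add hS hcov
  refine ⟨cov, β, hm, hβ.smooth, fun i X Y hX hY x ↦ ?_⟩
  rw [← endDeriv_apply (S.isSmoothEnd_φ i) hY]
  generalize Y x = v, X x = u
  let Q (u v : TangentSpace I x) : TangentSpace I x :=
    endDeriv cov (S.isSmoothEnd_φ i) x v u - β x • (S.η (i + 2) x u • S.φ (i + 1) x v
        - S.η (i + 1) x u • S.φ (i + 2) x v)
  have hQξ : ∀ u j, Q u (S.ξ j x) = 0 := fun u j ↦ sub_eq_zero.2 (endDeriv_φ_ξ hξ i j x u)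
  have hQhor : ∀ u v, Q u v = Q u (S.hor x v) := by
    intro u v
    have : Q u (S.hor x v) = Q u v - ∑ j, S.η j x v • Q u (S.ξ j x) := by
      simp only [Q, hor_apply, Fin.sum_univ_three, map_sub, map_add, map_smul, sub_apply, add_apply,
        smul_apply]
      module
    simp [this, hQξ]
  have hQhor' : ∀ u v, Q u v = Q (S.hor x u) v + ∑ j, S.η j x u • Q (S.ξ j x) v := by
    intro u v
    simp only [Q, hor_apply, Fin.sum_univ_three, map_sub, map_add, map_smul, smul_eq_mul]
    module
  have hQskew : ∀ u v w, S.g.inner x (Q u v) w = -S.g.inner x (Q u w) v := by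
    intro u v w
    simp only [Q, map_sub, sub_apply, map_smul, smul_apply, smul_eq_mul, S.φ_skew _ x v,
      S.g.symm x v, hm.endDeriv_skew (S.isSmoothEnd_φ i) (S.φ_skew i) x u v w]
    ring
  have hQ : ∀ u v w, S.HorizontalAt x v → S.HorizontalAt x w → S.g.inner x (Q u v) w = 0 := by
    intro u v w hv hw
    have h1 : S.g.inner x (Q (S.hor x u) v) w = 0 := by
      have hu := S.horizontalAt_hor x u
      simp [Q, hu _, inner_endDeriv_of_horizontalAt hS hcov i hu hv hw]
    have h2 : ∀ j, S.g.inner x (Q (S.ξ j x) v) w = 0 := by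
      intro j
      simp only [Q, map_sub, sub_apply, map_smul, smul_apply, smul_eq_mul]
      rw [inner_endDeriv_ξ_of_horizontalAt hβ hm
        (fun i x v hv ↦ by simp [hξ, hv _]) i j hv hw, sub_self]
    rw [hQhor']
    simp [h1, h2]
  refine sub_eq_zero.1 (eq_of_inner_eq S.g fun w ↦ ?_)
  change S.g.inner x (Q u v) w = _
  rw [hQhor, hQskew, hQhor, hQ u _ _ (S.horizontalAt_hor x w) (S.horizontalAt_hor x v)]
  simp

end ConstructionOfConnection

end AlmostThreeContactMetric

end ThreeContact

end

theorem mainTheorem1 {n : ℕ} {M : Type*} [TopologicalSpace M] [T2Space M]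
    [SecondCountableTopology M]
    [ChartedSpace (EuclideanSpace ℝ (Fin (4 * n + 3))) M] [IsManifold (𝓡 (4 * n + 3)) ∞ M]
    (S : ThreeContact.AlmostThreeContactMetric (𝓡 (4 * n + 3)) M) :
    -- existence
    ((∃ cov β, S.IsCanonicalConnection cov β) ↔ S.IsCanonical) ∧
    -- uniqueness of the connection and of the function
    (1 ≤ n → ∀ cov cov' β β', S.IsCanonicalConnection cov β → S.IsCanonicalConnection cov' β' →
      β = β' ∧
      ∀ (x : M) (Y : Π x : M, TangentSpace (𝓡 (4 * n + 3)) x),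
        MDifferentiableAt (𝓡 (4 * n + 3)) (𝓡 (4 * n + 3)).tangent
          (fun y ↦ (⟨y, Y y⟩ : TangentBundle (𝓡 (4 * n + 3)) M)) x →
        cov Y x = cov' Y x) ∧
    -- properties of the connection
    (∀ cov β, S.IsCanonicalConnection cov β →
      (∀ a : Fin 3 → ℝ, ∑ i, a i ^ 2 = 1 →
        S.IsCompatibleConnection a cov ∧ S.TorsionFormulas a cov) ∧
      S.IsReebKillingFunction β ∧
      (1 ≤ n → ∀ β', S.IsReebKillingFunction β' → β' = β) ∧
      (∃ δ, S.IsReebCommutatorFunction δ) ∧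
      (∀ δ, S.IsReebCommutatorFunction δ → ∀ x,
        ThreeContact.torsion₃ (𝓡 (4 * n + 3)) S.g cov x (S.ξ 0 x) (S.ξ 1 x) (S.ξ 2 x)
          = 2 * (β x - δ x))) := by
  refine ⟨⟨fun ⟨_, _, h⟩ ↦ h.isCanonical, fun h ↦ h.exists_isCanonicalConnection⟩,
    fun hn cov cov' β β' h h' ↦ ?_, fun cov β h ↦ ⟨fun a ha ↦
      ⟨h.isCompatibleConnection a, h.torsionFormulas ha⟩, h.isReebKillingFunction,
      fun hn β' hβ' ↦ hβ'.unique (by simp; omega) h.isReebKillingFunction,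
      h.exists_isReebCommutatorFunction, fun δ hδ x ↦ h.torsion_ξ hδ x⟩⟩
  obtain rfl := h.isReebKillingFunction.unique (by simp; omega) h'.isReebKillingFunction
  exact ⟨rfl, fun x Y hY ↦ h.cov_eq h' hY⟩
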